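/- Let $n \ge 0$, and write points of $\mathbb{R}^{n+1}$ as $(x,\rho)$ with $x\in\mathbb{R}^n$, $\rho\in\mathbb{R}$; let $\mathbb{H}_-=\{(x,\rho):\rho<0\}$. Let $k\le -1$ be real and let $A\in\Psi^k(\mathbb{R}^{n+1})$ be an arbitrary pseudodifferential operator of order $k$, that is, $$Au(z)=\frac{1}{(2\pi)^{n+1}}\int_{\mathbb{R}^{n+1}} a(z,\zeta)\,\widehat u(\zeta)\,e^{iz\cdot\zeta}\,d\zeta ,$$ (in the sense of distributions, for all tempered distributions $u$), where $a\in C^\infty(\mathbb{R}^{n+1}\times\mathbb{R}^{n+1})$ is complex-valued and satisfies, for every compact $K\subset\mathbb{R}^{n+1}$ and all multi-indices $\alpha,\beta$, $|\partial_z^\alpha\partial_\zeta^\beta a(z,\zeta)|\le C_{K,\alpha,\beta}(1+|\zeta|)^{k-|\beta|}$ for $z\in K$, $\zeta\in\mathbb{R}^{n+1}$. No further assumption (such as meromorphy in the variable dual to $\rho$) is made on $a$. Let $s$ be a real number with $s\le |k|-1$ ($s$ may be negative). Then for every bounded open set $V\subset\mathbb{R}^{n+1}$ there is a constant $C$, depending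 on $A$, $s$ and $V$ (and $n$, $k$) only, such that for every $g_b\in W^{s+k+1/2}(\mathbb{R}^n)$ (in particular for every $g_b\in W^s(\mathbb{R}^n)$), with $g=g_b(x)\,\delta(\rho)$, that is, $\langle g,\psi\rangle=\langle g_b,\psi(\cdot,0)\rangle$, the distribution $Ag$ restricted to $\mathbb{H}_-\cap V$ belongs to $W^s(\mathbb{H}_-\cap V)$ and $$\|Ag\|_{W^s(\mathbb{H}_-\cap V)}\le C\,\|g_b\|_{W^{s+k+1/2}(\mathbb{R}^n)} .$$ Here $W^t(\mathbb{R}^m)$ is the $L^2$-based Sobolev space of real order $t$, with norm $\|(1+|D|^2)^{t/2}u\|_{L^2}$, and for open $\Omega$ the space $W^s(\Omega)$ consists of the restrictions to $\Omega$ of elements of $W^s(\mathbb{R}^{n+1})$, with the quotient norm $\|T\|_{W^s(\Omega)}=\inf\{\|U\|_{W^s(\mathbb{R}^{n+1})}:U|_\Omega=T\}$. (So the estimate $\|Ag\|_{W^s_{loc}(\mathbb{H}_-)}\lesssim\|g_b\|_{W^{s+k+1/2}(\mathbb{R}^n)}$ holds locally up to the boundary $\rho=0$.) -/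

import Mathlib

open MeasureTheory Set
open scoped ContDiff SchwartzMap Distributions RealInnerProductSpace ENNReal NNReal
  FourierTransform

namespace PsiDO
open TopologicalSpace
set_option linter.unusedSectionVars false
set_option linter.unusedVariables false

/-! ### Oscillatory integrals of amplitudes

The facts of this part serve only to show that the transpose of a pseudodifferential operator maps
test functions continuously to Schwartz functions, so that the operator itself is defined on all
tempered distributions. -/

/-- The integral `∫ exp (i x·ξ) b(x, ξ) dx`, as a function of `ξ`. -/
noncomputable def oscInt {E : Type*} [NormedAddCommGroup E] [InnerProductSpace ℝ E]
    [MeasurableSpace E] [BorelSpace E] [FiniteDimensional ℝ E]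
    {F : Type*} [NormedAddCommGroup F] [NormedSpace ℂ F] (b : E → E → F) (ξ : E) : F :=
  ∫ x, Complex.exp (Complex.I * (⟪x, ξ⟫ : ℝ)) • b x ξ

section
variable {E : Type*} [NormedAddCommGroup E] [InnerProductSpace ℝ E]
    [MeasurableSpace E] [BorelSpace E] [FiniteDimensional ℝ E]
    {F : Type*} [NormedAddCommGroup F] [NormedSpace ℂ F]

theorem contDiff_bilin {V G₁ G₂ D : Type*} [NormedAddCommGroup V] [NormedSpace ℝ V]
    [NormedAddCommGroup G₁] [NormedSpace ℝ G₁] [NormedAddCommGroup G₂] [NormedSpace ℝ G₂]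
    [NormedAddCommGroup D] [NormedSpace ℝ D] (B : V →L[ℝ] G₁ →L[ℝ] G₂) {f : D → V} {g : D → G₁}
    (hf : ContDiff ℝ ∞ f) (hg : ContDiff ℝ ∞ g) : ContDiff ℝ ∞ (fun y ↦ B (f y) (g y)) :=
  (B.contDiff.comp hf).clm_apply hg

/-- The real-bilinear map `(x, v) ↦ (η ↦ ⟪x, η⟫ • (i • v))`. -/
noncomputable def bilinB (E F : Type*) [NormedAddCommGroup E] [InnerProductSpace ℝ E]
    [NormedAddCommGroup F] [NormedSpace ℂ F] : E →L[ℝ] F →L[ℝ] E →L[ℝ] F :=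
  ((ContinuousLinearMap.compL ℝ F F (E →L[ℝ] F)).flip
    (Complex.I • ContinuousLinearMap.id ℝ F)).comp
    ((ContinuousLinearMap.smulRightL ℝ E F).comp (innerSL ℝ))

/-- The amplitude of the derivative of `oscInt b`. -/
noncomputable def nextAmp (b : E → E → F) (x ξ : E) : E →L[ℝ] F :=
  fderiv ℝ (b x) ξ + bilinB E F x (b x ξ)

theorem contDiff_slice {b : E → E → F} (hb : ContDiff ℝ ∞ (fun p : E × E ↦ b p.1 p.2)) (x : E) :
    ContDiff ℝ ∞ (b x) := hb.comp (contDiff_const.prodMk contDiff_id)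

theorem contDiff_fderiv_slice {b : E → E → F} (hb : ContDiff ℝ ∞ (fun p : E × E ↦ b p.1 p.2)) :
    ContDiff ℝ ∞ (fun p : E × E ↦ fderiv ℝ (b p.1) p.2) := by
  refine ContDiff.fderiv (f := fun p : E × E ↦ b p.1) (m := ∞) ?_ contDiff_snd (by simp)
  exact hb.comp ((contDiff_fst.comp contDiff_fst).prodMk contDiff_snd)

theorem contDiff_nextAmp {b : E → E → F} (hb : ContDiff ℝ ∞ (fun p : E × E ↦ b p.1 p.2)) :
    ContDiff ℝ ∞ (fun p : E × E ↦ nextAmp b p.1 p.2) := by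
  exact (contDiff_fderiv_slice hb).add
    (contDiff_bilin (G₁ := F) (G₂ := E →L[ℝ] F) (bilinB E F) contDiff_fst hb)

theorem contDiff_iteratedFDeriv_slice {b : E → E → F}
    (hb : ContDiff ℝ ∞ (fun p : E × E ↦ b p.1 p.2)) (j : ℕ) :
    ContDiff ℝ ∞ (fun p : E × E ↦ iteratedFDeriv ℝ j (b p.1) p.2) := by
  induction j with
  | zero =>
    simp only [iteratedFDeriv_zero_eq_comp, Function.comp_def]
    exact (continuousMultilinearCurryFin0 ℝ E F).symm.contDiff.comp hb
  | succ j ih =>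
    simp only [iteratedFDeriv_succ_eq_comp_left, Function.comp_def]
    have hL := LinearIsometryEquiv.contDiff (𝕜 := ℝ) (n := ∞) (E := E →L[ℝ] E [×j]→L[ℝ] F)
      (F := E [×(j + 1)]→L[ℝ] F)
      (continuousMultilinearCurryLeftEquiv ℝ (fun _ : Fin (j + 1) ↦ E) F).symm
    refine hL.comp (f := fun p : E × E ↦ fderiv ℝ (iteratedFDeriv ℝ j (b p.1)) p.2) ?_
    refine ContDiff.fderiv (f := fun p : E × E ↦ iteratedFDeriv ℝ j (b p.1)) (m := ∞) ?_
      contDiff_snd (by simp)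
    exact ih.comp ((contDiff_fst.comp contDiff_fst).prodMk contDiff_snd)

theorem hasFDerivAt_phase (b : E → E → F) (hb : ContDiff ℝ ∞ (fun p : E × E ↦ b p.1 p.2))
    (x ξ : E) : HasFDerivAt (fun ξ ↦ Complex.exp (Complex.I * (⟪x, ξ⟫ : ℝ)) • b x ξ)
      (Complex.exp (Complex.I * (⟪x, ξ⟫ : ℝ)) • nextAmp b x ξ) ξ := by
  have h1 : HasFDerivAt (fun ξ : E ↦ (⟪x, ξ⟫ : ℝ)) (innerSL ℝ x) ξ := (innerSL ℝ x).hasFDerivAt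
  have h2 := ((Complex.ofRealCLM.hasFDerivAt.comp ξ h1).const_mul Complex.I).cexp
  have h3 := h2.smul (((contDiff_slice hb x).differentiable (by simp)) ξ).hasFDerivAt
  refine h3.congr_fderiv ?_
  ext v
  simp only [nextAmp, bilinB, smul_smul, ← Complex.coe_smul, Function.comp_apply,
    add_apply, smul_apply, Complex.ofRealCLM_apply,
    ContinuousLinearMap.smulRight_apply, ContinuousLinearMap.comp_apply, innerSL_apply_apply,
    smul_add, ContinuousLinearMap.flip_apply, ContinuousLinearMap.compL_apply, smul_eq_mul,
    ContinuousLinearMap.smulRightL_apply_apply, ContinuousLinearMap.id_apply]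
  congr 2
  ring

variable {K : Set E}

theorem nextAmp_supp (hK : IsCompact K) {b : E → E → F} (hs : ∀ x ∉ K, ∀ ξ, b x ξ = 0) :
    ∀ x ∉ K, ∀ ξ, nextAmp b x ξ = 0 := by
  intro x hx ξ
  have : b x = fun _ ↦ 0 := funext (hs x hx)
  simp [nextAmp, this]

theorem continuous_phase (b : E → E → F) (hb : Continuous (fun p : E × E ↦ b p.1 p.2)) :
    Continuous (fun p : E × E ↦ Complex.exp (Complex.I * (⟪p.1, p.2⟫ : ℝ)) • b p.1 p.2) := by
  fun_prop

theorem integrable_phase (hK : IsCompact K) {b : E → E → F}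
    (hb : Continuous (fun p : E × E ↦ b p.1 p.2)) (hs : ∀ x ∉ K, ∀ ξ, b x ξ = 0) (ξ : E) :
    Integrable (fun x ↦ Complex.exp (Complex.I * (⟪x, ξ⟫ : ℝ)) • b x ξ) := by
  refine Continuous.integrable_of_hasCompactSupport ?_ ?_
  · exact (continuous_phase b hb).comp (continuous_id.prodMk continuous_const)
  · refine HasCompactSupport.intro hK fun x hx ↦ ?_
    rw [hs x hx, smul_zero]

theorem hasFDerivAt_oscInt (hK : IsCompact K) {b : E → E → F}
    (hb : ContDiff ℝ ∞ (fun p : E × E ↦ b p.1 p.2)) (hs : ∀ x ∉ K, ∀ ξ, b x ξ = 0) (ξ : E) :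
    HasFDerivAt (oscInt b) (oscInt (nextAmp b) ξ) ξ := by
  have hc := (contDiff_nextAmp hb).continuous
  obtain ⟨C, hC⟩ := ((hK.prod (isCompact_closedBall ξ 1)).image hc).isBounded.exists_norm_le
  refine hasFDerivAt_integral_of_dominated_of_fderiv_le (𝕜 := ℝ) (bound := K.indicator fun _ ↦ C)
    (F' := fun ξ x ↦ Complex.exp (Complex.I * (⟪x, ξ⟫ : ℝ)) • nextAmp b x ξ)
    (Metric.closedBall_mem_nhds ξ one_pos) ?_ (integrable_phase hK hb.continuous hs ξ)
    (integrable_phase hK hc (nextAmp_supp hK hs) ξ).1 ?_ ?_ ?_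
  · exact Filter.Eventually.of_forall fun η ↦ (integrable_phase hK hb.continuous hs η).1
  · refine Filter.Eventually.of_forall fun x η hη ↦ ?_
    by_cases hx : x ∈ K
    · rw [norm_smul, mul_comm Complex.I, Complex.norm_exp_ofReal_mul_I, one_mul,
        indicator_of_mem hx]
      exact hC _ ⟨(x, η), ⟨hx, hη⟩, rfl⟩
    · rw [nextAmp_supp hK hs x hx, smul_zero, norm_zero, indicator_of_notMem hx]
  · exact (integrable_indicator_iff hK.measurableSet).2
      (integrableOn_const hK.measure_lt_top.ne)
  · exact Filter.Eventually.of_forall fun x η _ ↦ hasFDerivAt_phase b hb x η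

theorem fderiv_oscInt (hK : IsCompact K) {b : E → E → F}
    (hb : ContDiff ℝ ∞ (fun p : E × E ↦ b p.1 p.2)) (hs : ∀ x ∉ K, ∀ ξ, b x ξ = 0) :
    fderiv ℝ (oscInt b) = oscInt (nextAmp b) :=
  funext fun ξ ↦ (hasFDerivAt_oscInt hK hb hs ξ).fderiv

end

section
universe u
variable {E : Type u} [NormedAddCommGroup E] [InnerProductSpace ℝ E]
    [MeasurableSpace E] [BorelSpace E] [FiniteDimensional ℝ E]

theorem contDiff_oscInt_nat {K : Set E} (hK : IsCompact K) (l : ℕ) :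
    ∀ {F : Type u} [NormedAddCommGroup F] [NormedSpace ℂ F] {b : E → E → F},
    ContDiff ℝ ∞ (fun p : E × E ↦ b p.1 p.2) → (∀ x ∉ K, ∀ ξ, b x ξ = 0) →
    ContDiff ℝ l (oscInt b) := by
  induction l with
  | zero =>
    intro F _ _ b hb hs
    exact contDiff_zero.2 (continuous_iff_continuousAt.2 fun ξ ↦
      (hasFDerivAt_oscInt hK hb hs ξ).continuousAt)
  | succ l ih =>
    intro F _ _ b hb hs
    rw [Nat.cast_succ, contDiff_succ_iff_fderiv, fderiv_oscInt hK hb hs]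
    refine ⟨fun ξ ↦ (hasFDerivAt_oscInt hK hb hs ξ).differentiableAt, by simp, ?_⟩
    exact ih (contDiff_nextAmp hb) (nextAmp_supp hK hs)

end

section
universe u
variable {E : Type u} [NormedAddCommGroup E] [InnerProductSpace ℝ E]
    [MeasurableSpace E] [BorelSpace E] [FiniteDimensional ℝ E]

/-- Polynomial bounds of order `m` for the derivatives `∂_x^i ∂_ξ^j b` with `i, j ≤ N`. -/
def HasBound {F : Type*} [NormedAddCommGroup F] [NormedSpace ℂ F] (m N : ℕ) (C : ℝ)
    (b : E → E → F) : Prop :=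
  ∀ i ≤ N, ∀ j ≤ N, ∀ x ξ : E,
    ‖iteratedFDeriv ℝ i (fun y ↦ iteratedFDeriv ℝ j (b y) ξ) x‖ ≤ C * (1 + ‖ξ‖) ^ m

theorem iteratedFDeriv_zero_off {K : Set E} (hK : IsCompact K) {G : Type*} [NormedAddCommGroup G]
    [NormedSpace ℝ G] {f : E → G} (hf : ∀ x ∉ K, f x = 0) (i : ℕ) :
    ∀ x ∉ K, iteratedFDeriv ℝ i f x = 0 := by
  intro x hx
  by_contra h
  have h1 := support_iteratedFDeriv_subset (𝕜 := ℝ) (f := f) i h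
  refine hx (hK.isClosed.closure_subset_iff.2 (fun y hy ↦ ?_) h1)
  by_contra hy'
  exact hy (hf y hy')

theorem bilin_aux {K : Set E} (hK : IsCompact K) {G₁ G₂ : Type*} [NormedAddCommGroup G₁]
    [NormedSpace ℝ G₁] [NormedAddCommGroup G₂] [NormedSpace ℝ G₂] (B : E →L[ℝ] G₁ →L[ℝ] G₂)
    (i : ℕ) : ∃ c : ℝ, 0 ≤ c ∧ ∀ g : E → G₁, ContDiff ℝ ∞ g → (∀ x ∉ K, g x = 0) →
    ∀ A : ℝ, 0 ≤ A → (∀ p ≤ i, ∀ x, ‖iteratedFDeriv ℝ p g x‖ ≤ A) →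
    ∀ x, ‖iteratedFDeriv ℝ i (fun y ↦ B y (g y)) x‖ ≤ c * A := by
  have hR : ∀ p : ℕ, ∃ R : ℝ, 0 ≤ R ∧
      ∀ x ∈ K, ‖iteratedFDeriv ℝ p (id : E → E) x‖ ≤ R := by
    intro p
    have hc : Continuous (iteratedFDeriv ℝ p (id : E → E)) :=
      (contDiff_id (𝕜 := ℝ) (n := p)).continuous_iteratedFDeriv le_rfl
    obtain ⟨R, hR⟩ := (hK.image hc).isBounded.exists_norm_le
    exact ⟨max R 0, le_max_right _ _, fun x hx ↦ (hR _ ⟨x, hx, rfl⟩).trans (le_max_left _ _)⟩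
  choose R hR0 hR using hR
  have hB0 : 0 ≤ ‖B‖ := ContinuousLinearMap.opNorm_nonneg B
  refine ⟨‖B‖ * ∑ p ∈ Finset.range (i + 1), (i.choose p : ℝ) * R p, ?_, ?_⟩
  · exact mul_nonneg hB0
      (Finset.sum_nonneg fun p _ ↦ mul_nonneg (Nat.cast_nonneg _) (hR0 p))
  intro g hg hs A hA hgA x
  refine (B.norm_iteratedFDeriv_le_of_bilinear (f := id) contDiff_id hg x
      (n := i) (N := ∞) (mod_cast le_top)).trans ?_
  rw [mul_assoc, Finset.sum_mul]
  refine mul_le_mul_of_nonneg_left (Finset.sum_le_sum fun p hp ↦ ?_) hB0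
  by_cases hx : x ∈ K
  · exact mul_le_mul (mul_le_mul_of_nonneg_left (hR p x hx) (Nat.cast_nonneg _))
      (hgA _ (by omega) x) (norm_nonneg _) (mul_nonneg (Nat.cast_nonneg _) (hR0 p))
  · rw [iteratedFDeriv_zero_off hK hs _ x hx, norm_zero, mul_zero]
    have := hR0 p
    positivity

/-- The bilinear map induced by `bilinB` on `j`-linear maps. -/
noncomputable def bilinBj (E F : Type*) [NormedAddCommGroup E] [InnerProductSpace ℝ E]
    [NormedAddCommGroup F] [NormedSpace ℂ F] (j : ℕ) :
    E →L[ℝ] (E [×j]→L[ℝ] F) →L[ℝ] (E [×j]→L[ℝ] (E →L[ℝ] F)) :=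
  (ContinuousLinearMap.compContinuousMultilinearMapL ℝ (fun _ : Fin j ↦ E) F
    (E →L[ℝ] F)).comp (bilinB E F)

theorem iteratedFDeriv_nextAmp {F : Type u} [NormedAddCommGroup F] [NormedSpace ℂ F]
    {b : E → E → F} (hb : ContDiff ℝ ∞ (fun p : E × E ↦ b p.1 p.2)) (j : ℕ) (y ξ : E) :
    iteratedFDeriv ℝ j (nextAmp b y) ξ = (continuousMultilinearCurryRightEquiv' ℝ j E F)
        (iteratedFDeriv ℝ (j + 1) (b y) ξ) + bilinBj E F j y (iteratedFDeriv ℝ j (b y) ξ) := by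
  have s1 : ContDiff ℝ ∞ (b y) := contDiff_slice hb y
  have s2 : ContDiff ℝ ∞ (fderiv ℝ (b y)) := s1.fderiv_right (by simp)
  have s3 : ContDiff ℝ ∞ (bilinB E F y ∘ b y) := (bilinB E F y).contDiff.comp s1
  have e1 : nextAmp b y = fderiv ℝ (b y) + bilinB E F y ∘ b y := rfl
  rw [e1, iteratedFDeriv_add_apply (s2.of_le (mod_cast le_top)).contDiffAt
    (s3.of_le (mod_cast le_top)).contDiffAt]
  congr 1
  · rw [iteratedFDeriv_succ_eq_comp_right, Function.comp_apply,
      LinearIsometryEquiv.apply_symm_apply]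
  · exact (bilinB E F y).iteratedFDeriv_comp_left
      (s1.of_le (n := ∞) (m := j) (mod_cast le_top)).contDiffAt le_rfl

theorem nextAmp_bound_aux {K : Set E} (hK : IsCompact K) (F : Type u) [NormedAddCommGroup F]
    [NormedSpace ℂ F] (N i j : ℕ) (hi : i ≤ N) (hj : j ≤ N) : ∃ c : ℝ, 0 ≤ c ∧
    ∀ (m : ℕ) (b : E → E → F), ContDiff ℝ ∞ (fun p : E × E ↦ b p.1 p.2) →
    (∀ x ∉ K, ∀ ξ, b x ξ = 0) → ∀ C : ℝ, 0 ≤ C → HasBound m (N + 1) C b → ∀ x ξ : E,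
    ‖iteratedFDeriv ℝ i (fun y ↦ iteratedFDeriv ℝ j (nextAmp b y) ξ) x‖
      ≤ (c * C) * (1 + ‖ξ‖) ^ m := by
  obtain ⟨c, hc0, hc⟩ := bilin_aux (G₁ := E [×j]→L[ℝ] F) (G₂ := E [×j]→L[ℝ] (E →L[ℝ] F))
    hK (bilinBj E F j) i
  refine ⟨1 + c, by positivity, ?_⟩
  intro m b hb hs C hC hB x ξ
  have hsm : ∀ j, ContDiff ℝ ∞ (fun y ↦ iteratedFDeriv ℝ j (b y) ξ) := fun j ↦
    (contDiff_iteratedFDeriv_slice hb j).comp (contDiff_id.prodMk (contDiff_const (c := ξ)))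
  have hdec : (fun y ↦ iteratedFDeriv ℝ j (nextAmp b y) ξ) =
      (continuousMultilinearCurryRightEquiv' ℝ j E F ∘ fun y ↦
        iteratedFDeriv ℝ (j + 1) (b y) ξ) +
      fun y ↦ bilinBj E F j y (iteratedFDeriv ℝ j (b y) ξ) :=
    funext fun y ↦ iteratedFDeriv_nextAmp hb j y ξ
  have t1 : ContDiff ℝ ∞ (continuousMultilinearCurryRightEquiv' ℝ j E F ∘ fun y ↦
        iteratedFDeriv ℝ (j + 1) (b y) ξ) :=
    (LinearIsometryEquiv.contDiff (𝕜 := ℝ) (E := E [×(j + 1)]→L[ℝ] F)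
      (F := E [×j]→L[ℝ] (E →L[ℝ] F)) _).comp (hsm (j + 1))
  have t2 : ContDiff ℝ ∞ (fun y ↦ bilinBj E F j y (iteratedFDeriv ℝ j (b y) ξ)) :=
    contDiff_bilin (G₁ := E [×j]→L[ℝ] F) (G₂ := E [×j]→L[ℝ] (E →L[ℝ] F)) (bilinBj E F j)
      contDiff_id (hsm j)
  rw [hdec, iteratedFDeriv_add_apply (t1.of_le (mod_cast le_top)).contDiffAt
      (t2.of_le (mod_cast le_top)).contDiffAt]
  refine (norm_add_le _ _).trans ?_
  rw [add_mul, add_mul, one_mul]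
  refine add_le_add ?_ ?_
  · refine (LinearIsometryEquiv.norm_iteratedFDeriv_comp_left (𝕜 := ℝ)
      (F := E [×(j + 1)]→L[ℝ] F) (G := E [×j]→L[ℝ] (E →L[ℝ] F)) _ _ _ _).trans_le ?_
    exact hB i (by omega) (j + 1) (by omega) x ξ
  · rw [mul_assoc]
    refine hc _ (hsm j) (fun y hy ↦ ?_) _ (by positivity)
      (fun p hp y ↦ hB p (by omega) j (by omega) y ξ) x
    have : b y = fun _ ↦ 0 := funext (hs y hy)
    simp [this]

theorem nextAmp_bound {K : Set E} (hK : IsCompact K) (F : Type u) [NormedAddCommGroup F]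
    [NormedSpace ℂ F] (N : ℕ) : ∃ c : ℝ, 0 ≤ c ∧
    ∀ (m : ℕ) (b : E → E → F), ContDiff ℝ ∞ (fun p : E × E ↦ b p.1 p.2) →
    (∀ x ∉ K, ∀ ξ, b x ξ = 0) → ∀ C : ℝ, 0 ≤ C → HasBound m (N + 1) C b →
    HasBound m N (c * C) (nextAmp b) := by
  have := fun i j : Fin (N + 1) ↦ nextAmp_bound_aux hK F N i j (by omega) (by omega)
  choose c hc0 hc using this
  refine ⟨∑ i, ∑ j, c i j, Finset.sum_nonneg fun i _ ↦ Finset.sum_nonneg fun j _ ↦ hc0 i j, ?_⟩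
  intro m b hb hs C hC hB i hi j hj x ξ
  refine (hc ⟨i, by omega⟩ ⟨j, by omega⟩ m b hb hs C hC hB x ξ).trans ?_
  gcongr
  refine (Finset.single_le_sum (f := fun j ↦ c ⟨i, by omega⟩ j) (fun j _ ↦ hc0 _ j)
    (Finset.mem_univ (⟨j, by omega⟩ : Fin (N + 1)))).trans ?_
  exact Finset.single_le_sum (f := fun i ↦ ∑ j, c i j)
    (fun i _ ↦ Finset.sum_nonneg fun j _ ↦ hc0 i j)
    (Finset.mem_univ (⟨i, by omega⟩ : Fin (N + 1)))

theorem oscInt_decay_zero {K : Set E} (hK : IsCompact K) (F : Type u) [NormedAddCommGroup F]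
    [NormedSpace ℂ F] (P : ℕ) : ∃ c : ℝ, 0 ≤ c ∧
    ∀ (m : ℕ) (b : E → E → F), ContDiff ℝ ∞ (fun p : E × E ↦ b p.1 p.2) →
    (∀ x ∉ K, ∀ ξ, b x ξ = 0) → ∀ C : ℝ, 0 ≤ C → HasBound m P C b → ∀ ξ,
    ‖ξ‖ ^ P * ‖oscInt b ξ‖ ≤ c * C * (1 + ‖ξ‖) ^ m := by
  refine ⟨(2 * Real.pi) ^ P * (2 ^ P * ∑ p ∈ Finset.range 1 ×ˢ Finset.range (P + 1),
    (volume K).toReal), by positivity, ?_⟩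
  intro m b hb hs C hC hB ξ
  set f : E → F := fun x ↦ b x ξ with hf
  have hfs : ContDiff ℝ ∞ f := hb.comp (contDiff_id.prodMk contDiff_const)
  have hbd : ∀ p ≤ P, ∀ x, ‖iteratedFDeriv ℝ p f x‖ ≤
      K.indicator (fun _ ↦ C * (1 + ‖ξ‖) ^ m) x := by
    intro p hp x
    by_cases hx : x ∈ K
    · rw [indicator_of_mem hx]
      have h := hB p hp 0 (Nat.zero_le _) x ξ
      have e := LinearIsometryEquiv.norm_iteratedFDeriv_comp_left (𝕜 := ℝ)
        (continuousMultilinearCurryFin0 ℝ E F).symm f x p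
      rw [← e]
      exact h
    · rw [indicator_of_notMem hx, iteratedFDeriv_zero_off hK (fun y hy ↦ hs y hy ξ) p x hx,
        norm_zero]
  have hind : Integrable (K.indicator (fun _ : E ↦ C * (1 + ‖ξ‖) ^ m)) :=
    (integrable_indicator_iff hK.measurableSet).2 (integrableOn_const hK.measure_lt_top.ne)
  have hint : ∀ p : ℕ, Integrable (fun v ↦ ‖iteratedFDeriv ℝ p f v‖) := by
    intro p
    refine Continuous.integrable_of_hasCompactSupport
      (hfs.continuous_iteratedFDeriv (m := p) (mod_cast le_top)).norm ?_
    refine HasCompactSupport.intro hK fun x hx ↦ ?_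
    rw [iteratedFDeriv_zero_off hK (fun y hy ↦ hs y hy ξ) p x hx, norm_zero]
  have key := Real.pow_mul_norm_iteratedFDeriv_fourier_le (K := 0) (N := (P : ℕ∞)) (f := f)
    (hfs.of_le (mod_cast le_top)) (fun k n hk hn ↦ by
      have : k = 0 := by simpa using hk
      subst this
      simpa using hint n) (k := 0) (n := P) le_rfl le_rfl (-((2 * Real.pi)⁻¹ • ξ))
  have hosc : oscInt b ξ = 𝓕 f (-((2 * Real.pi)⁻¹ • ξ)) := by
    rw [← Real.fourierInv_eq_fourier_neg, Real.fourierInv_eq']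
    unfold oscInt
    congr 1
    funext x
    congr 2
    rw [inner_smul_right, mul_comm Complex.I]
    congr 2
    field_simp
  rw [norm_iteratedFDeriv_zero, ← hosc, norm_neg, norm_smul, mul_pow, norm_inv,
    Real.norm_of_nonneg (by positivity : (0:ℝ) ≤ 2 * Real.pi)] at key
  have hsum : ∑ p ∈ Finset.range (0 + 1) ×ˢ Finset.range (P + 1),
      ∫ v, ‖v‖ ^ p.1 * ‖iteratedFDeriv ℝ p.2 f v‖ ≤
      ∑ p ∈ Finset.range 1 ×ˢ Finset.range (P + 1),
        (volume K).toReal * (C * (1 + ‖ξ‖) ^ m) := by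
    rw [zero_add]
    refine Finset.sum_le_sum fun p hp ↦ ?_
    obtain ⟨hp1, hp2⟩ := Finset.mem_product.1 hp
    have hp1' : p.1 = 0 := by simpa using hp1
    have hp2' : p.2 ≤ P := by have := Finset.mem_range.1 hp2; omega
    simp only [hp1', pow_zero, one_mul]
    refine (integral_mono (hint _) hind (hbd _ hp2')).trans (le_of_eq ?_)
    rw [integral_indicator hK.measurableSet, setIntegral_const]
    rfl
  rw [← Finset.sum_mul] at hsum
  have hpi : (0:ℝ) < (2 * Real.pi) ^ P := by positivity
  have key2 : ‖ξ‖ ^ P * ‖oscInt b ξ‖ = (2 * Real.pi) ^ P *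
      (((2 * Real.pi)⁻¹ ^ P * ‖ξ‖ ^ P) * ‖oscInt b ξ‖) := by
    rw [inv_pow]
    field_simp
  rw [key2, mul_assoc ((2 * Real.pi) ^ P * _), mul_assoc ((2 * Real.pi) ^ P)]
  refine mul_le_mul_of_nonneg_left (key.trans ?_) hpi.le
  simp only [pow_zero, one_mul, Nat.cast_zero, mul_zero, zero_add]
  rw [mul_assoc]
  exact mul_le_mul_of_nonneg_left hsum (by positivity)

theorem oscInt_decay {K : Set E} (hK : IsCompact K) (m M l : ℕ) :
    ∀ (F : Type u) [NormedAddCommGroup F] [NormedSpace ℂ F], ∃ (N : ℕ) (c : ℝ), 0 ≤ c ∧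
    ∀ (b : E → E → F), ContDiff ℝ ∞ (fun p : E × E ↦ b p.1 p.2) →
    (∀ x ∉ K, ∀ ξ, b x ξ = 0) → ∀ C : ℝ, 0 ≤ C → HasBound m N C b → ∀ ξ,
    ‖ξ‖ ^ M * ‖iteratedFDeriv ℝ l (oscInt b) ξ‖ ≤ c * C := by
  induction l with
  | zero =>
    intro F _ _
    obtain ⟨c0, hc0, h0⟩ := oscInt_decay_zero hK F 0
    obtain ⟨c1, hc1, h1⟩ := oscInt_decay_zero hK F (M + m)
    refine ⟨M + m, 2 ^ (M + m - 1) * (c0 + c1), by positivity, ?_⟩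
    intro b hb hs C hC hB ξ
    have e0 := h0 m b hb hs C hC
      (fun i hi j hj ↦ hB i (by omega) j (by omega)) ξ
    have e1 := h1 m b hb hs C hC hB ξ
    rw [norm_iteratedFDeriv_zero]
    have hpos : 0 < (1 + ‖ξ‖) ^ m := by positivity
    have h2 : (1 + ‖ξ‖) ^ (M + m) * ‖oscInt b ξ‖ ≤
        2 ^ (M + m - 1) * (c0 + c1) * C * (1 + ‖ξ‖) ^ m := by
      calc _ ≤ 2 ^ (M + m - 1) * (1 ^ (M + m) + ‖ξ‖ ^ (M + m)) * ‖oscInt b ξ‖ := by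
            gcongr
            exact add_pow_le zero_le_one (norm_nonneg _) _
        _ = 2 ^ (M + m - 1) * (‖ξ‖ ^ 0 * ‖oscInt b ξ‖ + ‖ξ‖ ^ (M + m) * ‖oscInt b ξ‖) := by
            rw [one_pow, pow_zero]; ring
        _ ≤ 2 ^ (M + m - 1) * (c0 * C * (1 + ‖ξ‖) ^ m + c1 * C * (1 + ‖ξ‖) ^ m) := by
            gcongr
        _ = _ := by ring
    refine le_of_mul_le_mul_right (le_trans ?_ h2) hpos
    rw [pow_add, mul_right_comm]
    gcongr
    linarith
  | succ l ih =>
    intro F _ _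
    obtain ⟨N, c, hc, h⟩ := ih (E →L[ℝ] F)
    obtain ⟨c', hc', h'⟩ := nextAmp_bound hK F N
    refine ⟨N + 1, c * c', by positivity, ?_⟩
    intro b hb hs C hC hB ξ
    rw [← norm_iteratedFDeriv_fderiv, fderiv_oscInt hK hb hs, mul_assoc]
    exact h _ (contDiff_nextAmp hb) (nextAmp_supp hK hs) _ (by positivity)
      (h' m b hb hs C hC hB) ξ

end

/-! ### Symbols and pseudodifferential operators -/

section
variable {E : Type} [NormedAddCommGroup E] [InnerProductSpace ℝ E]

/-- The class `S^k(E)` of symbols of order `k` (of type `(1, 0)`, with estimates that are locally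
uniform in the base variable): smooth functions `a(x, ξ)` on `E × E` such that for every compact
`K` and all `i, j` one has `|∂_x^i ∂_ξ^j a(x, ξ)| ≤ C (1 + |ξ|)^(k - j)` for `x ∈ K`, `ξ ∈ E`.
Here `∂_x^i ∂_ξ^j a` is the Fréchet derivative, which collects all partial derivatives of order
`i` in `x` and of order `j` in `ξ`. -/
structure Symbol (E : Type) [NormedAddCommGroup E] [InnerProductSpace ℝ E] (k : ℝ) where
  toFun : E → E → ℂ
  smooth : ContDiff ℝ ∞ (fun p : E × E ↦ toFun p.1 p.2)
  bound : ∀ K : Set E, IsCompact K → ∀ i j : ℕ, ∃ C : ℝ, ∀ x ∈ K, ∀ ξ : E,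
    ‖iteratedFDeriv ℝ i (fun y ↦ iteratedFDeriv ℝ j (toFun y) ξ) x‖ ≤ C * (1 + ‖ξ‖) ^ (k - j)

variable {k : ℝ} (a : Symbol E k)

/-- The amplitude `φ(x) a(x, ξ)`. -/
def amp (φ : E → ℂ) (x ξ : E) : ℂ := φ x • a.toFun x ξ

theorem contDiff_amp {φ : E → ℂ} (hφ : ContDiff ℝ ∞ φ) :
    ContDiff ℝ ∞ (fun p : E × E ↦ amp a φ p.1 p.2) :=
  (hφ.comp contDiff_fst).smul a.smooth

theorem amp_supp {K : Set E} {φ : E → ℂ} (hs : ∀ x ∉ K, φ x = 0) :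
    ∀ x ∉ K, ∀ ξ, amp a φ x ξ = 0 := by
  intro x hx ξ
  rw [amp, hs x hx, zero_smul]

variable [MeasurableSpace E] [BorelSpace E] [FiniteDimensional ℝ E]

theorem amp_bound_aux {K : Set E} (hK : IsCompact K) (i j : ℕ) : ∃ c : ℝ, 0 ≤ c ∧
    ∀ φ : E → ℂ, ContDiff ℝ ∞ φ → (∀ x ∉ K, φ x = 0) → ∀ C : ℝ, 0 ≤ C →
    (∀ p ≤ i, ∀ x, ‖iteratedFDeriv ℝ p φ x‖ ≤ C) → ∀ x ξ : E,
    ‖iteratedFDeriv ℝ i (fun y ↦ iteratedFDeriv ℝ j (amp a φ y) ξ) x‖ ≤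
      c * C * (1 + ‖ξ‖) ^ ⌈k⌉₊ := by
  have hA : ∀ p : ℕ, ∃ A : ℝ, 0 ≤ A ∧ ∀ x ∈ K, ∀ ξ,
      ‖iteratedFDeriv ℝ p (fun y ↦ iteratedFDeriv ℝ j (a.toFun y) ξ) x‖ ≤
        A * (1 + ‖ξ‖) ^ ⌈k⌉₊ := by
    intro p
    obtain ⟨A, hA⟩ := a.bound K hK p j
    refine ⟨max A 0, le_max_right _ _, fun x hx ξ ↦ (hA x hx ξ).trans ?_⟩
    have h1 : (1 + ‖ξ‖) ^ (k - j) ≤ (1 + ‖ξ‖) ^ ⌈k⌉₊ := by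
      rw [← Real.rpow_natCast]
      refine Real.rpow_le_rpow_of_exponent_le (by linarith [norm_nonneg ξ]) ?_
      have := Nat.le_ceil k
      have : (0 : ℝ) ≤ j := Nat.cast_nonneg j
      linarith
    exact mul_le_mul (le_max_left _ _) h1 (by positivity) (le_max_right _ _)
  choose A hA0 hA using hA
  refine ⟨∑ p ∈ Finset.range (i + 1), (i.choose p : ℝ) * A (i - p),
    Finset.sum_nonneg fun p _ ↦ mul_nonneg (Nat.cast_nonneg _) (hA0 _), ?_⟩
  intro φ hφ hs C hC hφC x ξ
  have hsm : ContDiff ℝ ∞ (fun y ↦ iteratedFDeriv ℝ j (a.toFun y) ξ) :=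
    (contDiff_iteratedFDeriv_slice a.smooth j).comp
      (contDiff_id.prodMk (contDiff_const (c := ξ)))
  have e : (fun y ↦ iteratedFDeriv ℝ j (amp a φ y) ξ) =
      fun y ↦ φ y • iteratedFDeriv ℝ j (a.toFun y) ξ := by
    funext y
    exact iteratedFDeriv_const_smul_apply (𝕜 := ℝ) (a := φ y) (f := a.toFun y)
      ((contDiff_slice a.smooth y).of_le (mod_cast le_top)).contDiffAt
  rw [e]
  refine (norm_iteratedFDeriv_smul_le hφ hsm x (n := i) (mod_cast le_top)).trans ?_
  rw [Finset.sum_mul, Finset.sum_mul]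
  refine Finset.sum_le_sum fun p hp ↦ ?_
  have hp' : p ≤ i := by have := Finset.mem_range.1 hp; omega
  by_cases hx : x ∈ K
  · calc _ ≤ (i.choose p : ℝ) * C * (A (i - p) * (1 + ‖ξ‖) ^ ⌈k⌉₊) :=
        mul_le_mul (mul_le_mul_of_nonneg_left (hφC p hp' x) (Nat.cast_nonneg _))
          (hA _ x hx ξ) (norm_nonneg _) (by positivity)
      _ = _ := by ring
  · rw [iteratedFDeriv_zero_off hK hs p x hx, norm_zero, mul_zero, zero_mul]
    have := hA0 (i - p)
    positivity

theorem amp_bound {K : Set E} (hK : IsCompact K) (N : ℕ) : ∃ c : ℝ, 0 ≤ c ∧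
    ∀ φ : E → ℂ, ContDiff ℝ ∞ φ → (∀ x ∉ K, φ x = 0) → ∀ C : ℝ, 0 ≤ C →
    (∀ p ≤ N, ∀ x, ‖iteratedFDeriv ℝ p φ x‖ ≤ C) → HasBound ⌈k⌉₊ N (c * C) (amp a φ) := by
  have := fun i j : Fin (N + 1) ↦ amp_bound_aux a hK i j
  choose c hc0 hc using this
  refine ⟨∑ i, ∑ j, c i j, Finset.sum_nonneg fun i _ ↦ Finset.sum_nonneg fun j _ ↦ hc0 i j, ?_⟩
  intro φ hφ hs C hC hφC i hi j hj x ξ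
  refine (hc ⟨i, by omega⟩ ⟨j, by omega⟩ φ hφ hs C hC
    (fun p hp ↦ hφC p (hp.trans hi)) x ξ).trans ?_
  gcongr
  refine (Finset.single_le_sum (f := fun j ↦ c ⟨i, by omega⟩ j) (fun j _ ↦ hc0 _ j)
    (Finset.mem_univ (⟨j, by omega⟩ : Fin (N + 1)))).trans ?_
  exact Finset.single_le_sum (f := fun i ↦ ∑ j, c i j)
    (fun i _ ↦ Finset.sum_nonneg fun j _ ↦ hc0 i j)
    (Finset.mem_univ (⟨i, by omega⟩ : Fin (N + 1)))

theorem exists_sup_bound {K : Set E} (hK : IsCompact K) {φ : E → ℂ} (hφ : ContDiff ℝ ∞ φ)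
    (hs : ∀ x ∉ K, φ x = 0) (N : ℕ) :
    ∃ C : ℝ, 0 ≤ C ∧ ∀ p ≤ N, ∀ x, ‖iteratedFDeriv ℝ p φ x‖ ≤ C := by
  have : ∀ p : Fin (N + 1), ∃ C : ℝ, 0 ≤ C ∧ ∀ x, ‖iteratedFDeriv ℝ p φ x‖ ≤ C := by
    intro p
    obtain ⟨C, hC⟩ := (hφ.continuous_iteratedFDeriv (m := (p : ℕ))
      (mod_cast le_top)).bounded_above_of_compact_support
      (HasCompactSupport.intro hK (iteratedFDeriv_zero_off hK hs p))
    exact ⟨C, (norm_nonneg _).trans (hC 0), hC⟩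
  choose C hC0 hC using this
  refine ⟨∑ p, C p, Finset.sum_nonneg fun p _ ↦ hC0 p, fun p hp x ↦ (hC ⟨p, by omega⟩ x).trans ?_⟩
  exact Finset.single_le_sum (fun p _ ↦ hC0 p) (Finset.mem_univ _)

/-- The Schwartz function `ξ ↦ ∫ exp (i x·ξ) a(x, ξ) φ(x) dx` -/
noncomputable def oscSchwartz {K : Set E} (hK : IsCompact K) (φ : E → ℂ)
    (hφ : ContDiff ℝ ∞ φ) (hs : ∀ x ∉ K, φ x = 0) : 𝓢(E, ℂ) where
  toFun := oscInt (amp a φ)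
  smooth' := contDiff_infty.2 fun l ↦
    contDiff_oscInt_nat hK l (contDiff_amp a hφ) (amp_supp a hs)
  decay' M l := by
    obtain ⟨N, c, hc, h⟩ := oscInt_decay (E := E) hK ⌈k⌉₊ M l ℂ
    obtain ⟨c', hc', h'⟩ := amp_bound a hK N
    obtain ⟨C, hC, hφC⟩ := exists_sup_bound hK hφ hs N
    exact ⟨_, h _ (contDiff_amp a hφ) (amp_supp a hs) _ (by positivity) (h' φ hφ hs C hC hφC)⟩

theorem oscInt_amp_add {K : Set E} (hK : IsCompact K) {φ ψ : E → ℂ}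
    (hφ : ContDiff ℝ ∞ φ) (hs : ∀ x ∉ K, φ x = 0) (hψ : ContDiff ℝ ∞ ψ)
    (hs' : ∀ x ∉ K, ψ x = 0) (ξ : E) :
    oscInt (amp a (φ + ψ)) ξ = oscInt (amp a φ) ξ + oscInt (amp a ψ) ξ := by
  unfold oscInt
  rw [← integral_add (integrable_phase hK (contDiff_amp a hφ).continuous (amp_supp a hs) ξ)
    (integrable_phase hK (contDiff_amp a hψ).continuous (amp_supp a hs') ξ)]
  congr 1
  funext x
  simp only [amp, Pi.add_apply, smul_eq_mul]
  ring

theorem oscInt_amp_smul (c : ℂ) (φ : E → ℂ) (ξ : E) :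
    oscInt (amp a (c • φ)) ξ = c * oscInt (amp a φ) ξ := by
  unfold oscInt
  rw [← integral_const_mul]
  congr 1
  funext x
  simp only [amp, Pi.smul_apply, smul_eq_mul]
  ring

/-- On test functions supported in a fixed compact set, as a linear map. -/
noncomputable def oscLMOn (K : Compacts E) : 𝓓_{K}(E, ℂ) →ₗ[ℂ] 𝓢(E, ℂ) where
  toFun φ := oscSchwartz a K.isCompact φ φ.contDiff (fun x hx ↦ φ.zero_on_compl hx)
  map_add' φ ψ := by
    ext ξ
    exact oscInt_amp_add a K.isCompact φ.contDiff (fun x hx ↦ φ.zero_on_compl hx)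
      ψ.contDiff (fun x hx ↦ ψ.zero_on_compl hx) ξ
  map_smul' c φ := by
    ext ξ
    exact oscInt_amp_smul a c φ ξ

/-- On test functions supported in a fixed compact set, as a continuous linear map. -/
noncomputable def oscCLMOn (K : Compacts E) : 𝓓_{K}(E, ℂ) →L[ℂ] 𝓢(E, ℂ) where
  toLinearMap := oscLMOn a K
  cont := by
    refine WithSeminorms.continuous_of_isBounded (𝕝 := ℂ) (𝕝₂ := ℂ) (τ₁₂ := RingHom.id ℂ)
      (ContDiffMapSupportedIn.withSeminorms ℂ E ℂ ⊤ K) (schwartz_withSeminorms ℂ E ℂ)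
      (oscLMOn a K) (Seminorm.IsBounded.of_real fun q ↦ ?_)
    obtain ⟨M, l⟩ := q
    obtain ⟨N, c, hc, h⟩ := oscInt_decay (E := E) K.isCompact ⌈k⌉₊ M l ℂ
    obtain ⟨c', hc', h'⟩ := amp_bound a K.isCompact N
    refine ⟨Finset.range (N + 1), c * c', fun φ ↦ ?_⟩
    refine SchwartzMap.seminorm_le_bound ℂ M l _ (by positivity) fun ξ ↦ ?_
    rw [mul_assoc]
    refine h _ (contDiff_amp a φ.contDiff) (amp_supp a fun x hx ↦ φ.zero_on_compl hx) _
      (by positivity) (h' φ φ.contDiff (fun x hx ↦ φ.zero_on_compl hx) _ (by positivity) ?_) ξ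
    intro p hp x
    refine (ContDiffMapSupportedIn.norm_iteratedFDeriv_apply_le_seminorm_top ℂ).trans ?_
    exact Seminorm.le_finset_sup_apply (Finset.mem_range.2 (by omega))

/-- The map `φ ↦ (ξ ↦ ∫ exp (i x·ξ) a(x, ξ) φ(x) dx)` from test functions to Schwartz functions. -/
noncomputable def oscCLM : 𝓓((⊤ : Opens E), ℂ) →L[ℂ] 𝓢(E, ℂ) :=
  TestFunction.limitCLM ℂ
    (fun φ ↦ oscSchwartz a (K := tsupport φ) φ.hasCompactSupport φ φ.contDiff
      (fun _ hx ↦ image_eq_zero_of_notMem_tsupport hx))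
    (fun K _ ↦ oscCLMOn a K) (fun _ _ _ ↦ rfl)

/-- The map that sends a test function `φ` to the Schwartz function
`ξ ↦ ∫ exp (i x·(2πξ)) a(x, 2πξ) φ(x) dx`. The factors `2π` translate between the
frequency variable of Mathlib's Fourier transform, whose kernel is `exp (-2πi x·ξ)`, and the usual
one. -/
noncomputable def Symbol.transpose : 𝓓((⊤ : Opens E), ℂ) →L[ℂ] 𝓢(E, ℂ) :=
  (SchwartzMap.compCLMOfContinuousLinearEquiv ℂ (ContinuousLinearEquiv.smulLeft
    (Units.mk0 (2 * Real.pi) Real.two_pi_pos.ne'))).comp (oscCLM a)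

theorem Symbol.transpose_apply (φ : 𝓓((⊤ : Opens E), ℂ)) (ξ : E) :
    a.transpose φ ξ = ∫ x, Complex.exp (Complex.I * (⟪x, (2 * Real.pi) • ξ⟫ : ℝ)) *
      (φ x * a.toFun x ((2 * Real.pi) • ξ)) := rfl

/-- The space of distributions on `E`, the dual of the space of complex test functions. -/
abbrev Distr (E : Type) [NormedAddCommGroup E] [InnerProductSpace ℝ E] :=
  𝓓((⊤ : Opens E), ℂ) →Lₚₜ[ℂ] ℂ

/-- The pseudodifferential operator with symbol `a`,
`(Op(a) u)(x) = ∫ a(x, 2πξ) (𝓕 u)(ξ) exp (i x·(2πξ)) dξ`, with `𝓕` the Fourier transform of kernel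
`exp (-2πi x·ξ)`; in the usual frequency variable, `(2π)^(-d) ∫ a(x, ξ) û(ξ) exp (i x·ξ) dξ`. It is
defined on all tempered distributions by integrating against a test function `φ`:
`⟨Op(a) u, φ⟩ = ⟨𝓕 u, ξ ↦ ∫ exp (i x·(2πξ)) a(x, 2πξ) φ(x) dx⟩`. -/
noncomputable def Symbol.op : 𝓢'(E, ℂ) →L[ℂ] Distr E :=
  (PointwiseConvergenceCLM.precomp ℂ a.transpose).comp (FourierTransform.fourierCLM ℂ 𝓢'(E, ℂ))

theorem Symbol.op_apply (u : 𝓢'(E, ℂ)) (φ : 𝓓((⊤ : Opens E), ℂ)) :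
    a.op u φ = (𝓕 u) (a.transpose φ) := rfl

/-- The space `Ψ^k(E)` of pseudodifferential operators of order `k`. -/
def PseudoDiffOp (E : Type) [NormedAddCommGroup E] [InnerProductSpace ℝ E] [MeasurableSpace E]
    [BorelSpace E] [FiniteDimensional ℝ E] (k : ℝ) : Set (𝓢'(E, ℂ) →L[ℂ] Distr E) :=
  Set.range fun a : Symbol E k ↦ a.op

/-! ### Sobolev norms -/

/-- The norm of `W^s(E)`: the `L²` norm of `(1 + |D|²)^(s/2) u`, which is `⊤` if `u ∉ W^s(E)`. -/
noncomputable def sobolevNorm (s : ℝ) (u : 𝓢'(E, ℂ)) : ℝ≥0∞ :=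
  ⨅ (f : Lp ℂ 2 (volume : Measure E))
    (_ : TemperedDistribution.besselPotential E ℂ s u = (f : 𝓢'(E, ℂ))), ‖f‖ₑ

/-- The norm of `W^s(Ω)`, the space of restrictions to the open set `Ω` of elements of `W^s(E)`,
for a distribution `T`: the infimum of the norms in `W^s(E)` of the `U` that agree with `T` on `Ω`.
It is `⊤` if `T` is not in `W^s(Ω)`. -/
noncomputable def sobolevNormOn (s : ℝ) (Ω : Opens E) (T : Distr E) : ℝ≥0∞ :=
  ⨅ (U : 𝓢'(E, ℂ))
    (_ : ∀ φ : 𝓓((⊤ : Opens E), ℂ), tsupport φ ⊆ (Ω : Set E) →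
      U (φ.hasCompactSupport.toSchwartzMap φ.contDiff) = T φ), sobolevNorm s U

end

/-! ### The half-space -/

section

/-- The half-space of the points `(x, ρ)` of `ℝ^n × ℝ = ℝ^(n+1)` with `ρ < 0`. -/
def lowerHalfSpace (n : ℕ) : Opens (EuclideanSpace ℝ (Fin (n + 1))) where
  carrier := {z | z (Fin.last n) < 0}
  is_open' := isOpen_lt (by fun_prop) continuous_const

/-- The embedding `x ↦ (x, 0)` of `ℝ^n` into `ℝ^(n+1)`. -/
noncomputable def boundaryEmbedding (n : ℕ) :
    EuclideanSpace ℝ (Fin n) →ₗᵢ[ℝ] EuclideanSpace ℝ (Fin (n + 1)) where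
  toFun x := WithLp.toLp 2 (Fin.snoc (α := fun _ ↦ ℝ) x 0)
  map_add' x y := by
    ext i
    refine Fin.lastCases ?_ (fun i ↦ ?_) i <;> simp
  map_smul' c x := by
    ext i
    refine Fin.lastCases ?_ (fun i ↦ ?_) i <;> simp
  norm_map' x := by
    simp [EuclideanSpace.norm_eq, Fin.sum_univ_castSucc]

/-- The distribution `g(x) δ(ρ)` on `ℝ^(n+1)`, that is `ψ ↦ ⟨g, ψ(·, 0)⟩`, for a tempered
distribution `g` on `ℝ^n`. -/
noncomputable def boundaryLayer (n : ℕ) (g : 𝓢'(EuclideanSpace ℝ (Fin n), ℂ)) :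
    𝓢'(EuclideanSpace ℝ (Fin (n + 1)), ℂ) :=
  PointwiseConvergenceCLM.precomp ℂ
    (SchwartzMap.compCLMOfAntilipschitz ℂ
      (boundaryEmbedding n).toContinuousLinearMap.hasTemperateGrowth
      (boundaryEmbedding n).antilipschitz) g

end
end PsiDO

namespace PsiDO

/-! ### Inequalities -/

section
variable {E : Type*} [NormedAddCommGroup E]

/-! Put m = s + k. The assumption on `s` gives m ≤ -1, in particular m < -1/2, and then two facts
about full space suffice.

First, a layer g_b(x) δ(ρ) with g_b in W^(m+1/2)(ℝ^n) lies in W^m(ℝ^(n+1)). Its Fourier transform is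
that of g_b, constant in the variable τ dual to ρ, and ∫ (1 + |ξ|² + τ²)^m dτ is a multiple of (1 +
|ξ|²)^(m+1/2), finite because m < -1/2 (`lintegral_add_sq_rpow`, `lintegral_layerLift_sq`,
`fourier_boundaryLayer_eq_integral`).

Second, for a cutoff χ the operator χA maps W^(s+k) to W^s. On the Fourier side it has the kernel
`freqKernel`, the Fourier transform of χ(x) a(x, ζ) in x alone. Smoothness in x gives rapid decay in
η - ζ, and the symbol bound gives the factor (1 + |ζ|²)^(k/2) (`exists_freqKernel_le`). Peetre's
inequality absorbs the Sobolev weights (`exists_weightedKernel_le`), so the weighted kernel is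
dominated by an integrable function of η - ζ and is bounded on L² by Young's inequality.

If χ = 1 on V, then χAg agrees with Ag on all of V, across ρ = 0, so it is an admissible extension
in the quotient norm of the half-space part. The operator is defined by duality, so the agreement is
checked against test functions, with Fubini moving the kernel from one factor to the other
(`integral_mul_integral_kernel`). -/

theorem one_add_norm_sq_le (x y : E) :
    1 + ‖x‖ ^ 2 ≤ 2 * (1 + ‖x - y‖ ^ 2) * (1 + ‖y‖ ^ 2) := by
  have h : ‖x‖ ≤ ‖x - y‖ + ‖y‖ := by simpa using norm_add_le (x - y) y
  have h1 : ‖x‖ ^ 2 ≤ (‖x - y‖ + ‖y‖) ^ 2 := pow_le_pow_left₀ (norm_nonneg _) h 2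
  nlinarith [sq_nonneg (‖x - y‖ - ‖y‖), sq_nonneg (‖x - y‖ * ‖y‖)]

/-- Peetre's inequality. -/
theorem peetre (r : ℝ) (x y : E) : (1 + ‖x‖ ^ 2) ^ r ≤
    2 ^ |r| * (1 + ‖x - y‖ ^ 2) ^ |r| * (1 + ‖y‖ ^ 2) ^ r := by
  have hx : 0 < 1 + ‖x‖ ^ 2 := by positivity
  have hy : 0 < 1 + ‖y‖ ^ 2 := by positivity
  rcases le_total 0 r with hr | hr
  · rw [abs_of_nonneg hr, ← Real.mul_rpow (by positivity) (by positivity),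
      ← Real.mul_rpow (by positivity) (by positivity)]
    exact Real.rpow_le_rpow hx.le (one_add_norm_sq_le x y) hr
  -- For a negative exponent, the elementary inequality with x and y exchanged is raised to the
  -- power -r and then inverted.
  · have h := Real.rpow_le_rpow hy.le (one_add_norm_sq_le y x) (neg_nonneg.2 hr)
    rw [Real.mul_rpow (by positivity) hx.le, Real.mul_rpow (by positivity) (by positivity),
      norm_sub_rev, Real.rpow_neg hy.le, Real.rpow_neg hx.le] at h
    rw [abs_of_nonpos hr]
    have hx' := Real.rpow_pos_of_pos hx r
    have hy' := Real.rpow_pos_of_pos hy r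
    rw [← div_eq_mul_inv, le_div_iff₀ hx', inv_mul_le_iff₀ hy'] at h
    linarith

/-- Since (1 + cr)² ≥ 1 + r², a nonpositive power reverses the inequality. With c = 2π this turns
the symbol bound at 2πζ into the Sobolev weight at ζ without a constant. -/
theorem one_add_mul_rpow_le {k : ℝ} (hk : k ≤ 0) {c r : ℝ} (hc : 1 ≤ c) (hr : 0 ≤ r) :
    (1 + c * r) ^ k ≤ (1 + r ^ 2) ^ (k / 2) := by
  have h1 : (0 : ℝ) ≤ 1 + c * r := by positivity
  have h2 : (1 + c * r) ^ k = ((1 + c * r) ^ 2) ^ (k / 2) := by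
    rw [← Real.rpow_natCast, ← Real.rpow_mul h1]
    congr 1
    push_cast
    ring
  rw [h2]
  refine Real.rpow_le_rpow_of_nonpos (by positivity) ?_ (by linarith)
  have : r ≤ c * r := le_mul_of_one_le_left hr hc
  nlinarith

end

theorem sq_lintegral_mul_le {α : Type*} [MeasurableSpace α] (μ : Measure α) {f g : α → ℝ≥0∞}
    (hf : AEMeasurable f μ) (hg : AEMeasurable g μ) :
    (∫⁻ x, f x * g x ∂μ) ^ 2 ≤ (∫⁻ x, f x ^ 2 ∂μ) * ∫⁻ x, g x ^ 2 ∂μ := by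
  have h := ENNReal.lintegral_mul_le_Lp_mul_Lq μ (p := 2) (q := 2)
    (Real.holderConjugate_iff.2 ⟨by norm_num, by norm_num⟩) hf hg
  refine (pow_le_pow_left₀ zero_le h 2).trans_eq ?_
  rw [mul_pow, ← ENNReal.rpow_natCast, ← ENNReal.rpow_natCast, ← ENNReal.rpow_mul,
    ← ENNReal.rpow_mul]
  simp

/-- Cauchy–Schwarz for the splitting κ w = κ^(1/2) · (κ^(1/2) w). -/
theorem sq_lintegral_weight_mul_le {α : Type*} [MeasurableSpace α] (μ : Measure α)
    {κ w : α → ℝ≥0∞} (hκ : AEMeasurable κ μ) (hw : AEMeasurable w μ) :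
    (∫⁻ x, κ x * w x ∂μ) ^ 2 ≤ (∫⁻ x, κ x ∂μ) * ∫⁻ x, κ x * w x ^ 2 ∂μ := by
  have e1 : ∀ x, (κ x ^ (1 / 2 : ℝ)) ^ 2 = κ x := fun x ↦ by
    rw [← ENNReal.rpow_natCast, ← ENNReal.rpow_mul]
    simp
  have h := sq_lintegral_mul_le μ (hκ.pow_const (1 / 2 : ℝ)) ((hκ.pow_const (1 / 2 : ℝ)).mul hw)
  simp only [Pi.mul_apply, ← mul_assoc, mul_pow, ← pow_two, e1] at h
  exact h

/-- Young's inequality `‖κ * w‖₂ ≤ ‖κ‖₁ ‖w‖₂`. -/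
theorem lintegral_sq_convolution_le {E : Type*} [NormedAddCommGroup E] [InnerProductSpace ℝ E]
    [MeasurableSpace E] [BorelSpace E] [FiniteDimensional ℝ E] {κ w : E → ℝ≥0∞}
    (hκ : Measurable κ) (hw : AEMeasurable w) :
    ∫⁻ η, (∫⁻ ζ, κ (η - ζ) * w ζ) ^ 2 ≤ (∫⁻ θ, κ θ) ^ 2 * ∫⁻ ζ, w ζ ^ 2 := by
  have h1 : ∀ η : E, ∫⁻ ζ, κ (η - ζ) = ∫⁻ θ, κ θ := fun η ↦ lintegral_sub_left_eq_self κ η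
  have h2 : ∀ ζ : E, ∫⁻ η, κ (η - ζ) = ∫⁻ θ, κ θ := fun ζ ↦ lintegral_sub_right_eq_self κ ζ
  have hm : AEMeasurable (fun p : E × E ↦ κ (p.1 - p.2) * w p.2 ^ 2)
      ((volume : Measure E).prod volume) :=
    (hκ.comp (measurable_fst.sub measurable_snd)).aemeasurable.mul
      ((hw.comp_quasiMeasurePreserving Measure.quasiMeasurePreserving_snd).pow_const 2)
  -- Schur's argument: weighted Cauchy–Schwarz in ζ costs one factor ∫ κ, and Tonelli followed by
  -- integration in η gives the other.
  calc ∫⁻ η, (∫⁻ ζ, κ (η - ζ) * w ζ) ^ 2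
      ≤ ∫⁻ η, (∫⁻ θ, κ θ) * ∫⁻ ζ, κ (η - ζ) * w ζ ^ 2 := by
        refine lintegral_mono fun η ↦ ?_
        refine (sq_lintegral_weight_mul_le volume
          (hκ.comp (measurable_const.sub measurable_id)).aemeasurable hw).trans_eq ?_
        simp only [Function.comp_def, Pi.sub_apply, id_eq, h1]
    _ = (∫⁻ θ, κ θ) * ∫⁻ ζ, ∫⁻ η, κ (η - ζ) * w ζ ^ 2 := by
        rw [lintegral_const_mul'' _ hm.lintegral_prod_right', lintegral_lintegral_swap hm]
    _ = _ := by
        have : ∀ ζ, ∫⁻ η, κ (η - ζ) * w ζ ^ 2 = (∫⁻ θ, κ θ) * w ζ ^ 2 := fun ζ ↦ by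
          rw [lintegral_mul_const _ (by fun_prop), h2]
        simp only [this]
        rw [lintegral_const_mul'' _ (hw.pow_const 2), pow_two, mul_assoc]

/-- The substitution τ = √A σ takes A^m out of the integrand and √A out of the measure. With A = 1 +
|ξ|² this is the origin of the shift by 1/2 in the Sobolev order of the boundary datum. -/
theorem lintegral_add_sq_rpow (m : ℝ) {A : ℝ} (hA : 0 < A) :
    ∫⁻ τ : ℝ, ENNReal.ofReal ((A + τ ^ 2) ^ m) =
      ENNReal.ofReal (A ^ (m + 1 / 2)) * ∫⁻ τ : ℝ, ENNReal.ofReal ((1 + τ ^ 2) ^ m) := by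
  have hb : 0 < √A := Real.sqrt_pos.2 hA
  have hmap := Measure.map_addHaar_smul (volume : Measure ℝ) hb.ne'
  have h1 : ∫⁻ τ : ℝ, ENNReal.ofReal ((A + τ ^ 2) ^ m) ∂(Measure.map (√A • ·) volume) =
      ∫⁻ τ : ℝ, ENNReal.ofReal ((A + (√A • τ) ^ 2) ^ m) :=
    lintegral_map (by fun_prop) (by fun_prop)
  have h2 : ∀ τ : ℝ, ENNReal.ofReal ((A + (√A • τ) ^ 2) ^ m) =
      ENNReal.ofReal (A ^ m) * ENNReal.ofReal ((1 + τ ^ 2) ^ m) := fun τ ↦ by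
    rw [← ENNReal.ofReal_mul (by positivity), ← Real.mul_rpow hA.le (by positivity), smul_eq_mul,
      mul_pow, Real.sq_sqrt hA.le]
    ring_nf
  rw [hmap, lintegral_smul_measure] at h1
  simp only [h2] at h1
  rw [lintegral_const_mul _ (by fun_prop)] at h1
  have h3 : ENNReal.ofReal (√A) * ENNReal.ofReal |(√A ^ Module.finrank ℝ ℝ)⁻¹| = 1 := by
    rw [← ENNReal.ofReal_mul hb.le]
    simp [abs_of_pos hb, hb.ne']
  have h4 : ENNReal.ofReal (A ^ (m + 1 / 2)) = ENNReal.ofReal (√A) * ENNReal.ofReal (A ^ m) := by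
    rw [← ENNReal.ofReal_mul hb.le, Real.rpow_add hA, Real.sqrt_eq_rpow, mul_comm]
  rw [h4, mul_assoc, ← h1, smul_eq_mul, ← mul_assoc, h3, one_mul]

theorem lintegral_one_add_sq_rpow_lt_top {m : ℝ} (hm : m < -1 / 2) :
    ∫⁻ τ : ℝ, ENNReal.ofReal ((1 + τ ^ 2) ^ m) < ⊤ := by
  have h := integrable_rpow_neg_one_add_norm_sq (E := ℝ) (μ := volume) (r := -2 * m)
    (by simp; linarith)
  have h' := h.lintegral_lt_top
  simp only [Real.norm_eq_abs, sq_abs] at h'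
  convert h' using 4
  ring_nf

/-! ### Splitting off the last coordinate -/

/-- The decomposition of `ℝ^(n+1)` as `ℝ^n × ℝ`. -/
noncomputable def splitLast (n : ℕ) :
    EuclideanSpace ℝ (Fin (n + 1)) ≃ᵐ EuclideanSpace ℝ (Fin n) × ℝ :=
  (MeasurableEquiv.toLp 2 (Fin (n + 1) → ℝ)).symm.trans
    ((MeasurableEquiv.piFinSuccAbove (fun _ ↦ ℝ) (Fin.last n)).trans
      (MeasurableEquiv.prodComm.trans
        ((MeasurableEquiv.toLp 2 (Fin n → ℝ)).prodCongr (MeasurableEquiv.refl ℝ))))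

theorem splitLast_fst_apply {n : ℕ} (z : EuclideanSpace ℝ (Fin (n + 1))) (i : Fin n) :
    (splitLast n z).1 i = z i.castSucc := by
  change z (Fin.succAbove (Fin.last n) i) = _
  rw [Fin.succAbove_last]

theorem splitLast_snd {n : ℕ} (z : EuclideanSpace ℝ (Fin (n + 1))) :
    (splitLast n z).2 = z (Fin.last n) := rfl

theorem measurePreserving_splitLast (n : ℕ) : MeasurePreserving (splitLast n) := by
  have h1 := EuclideanSpace.volume_preserving_symm_measurableEquiv_toLp (Fin (n + 1))
  have h2 := volume_preserving_piFinSuccAbove (fun _ : Fin (n + 1) ↦ ℝ) (Fin.last n)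
  have h3 : MeasurePreserving (MeasurableEquiv.prodComm (α := ℝ) (β := Fin n → ℝ)) :=
    Measure.measurePreserving_swap
  have h4 : MeasurePreserving ((MeasurableEquiv.toLp 2 (Fin n → ℝ)).prodCongr
      (MeasurableEquiv.refl ℝ)) :=
    (PiLp.volume_preserving_toLp (Fin n)).prod (MeasurePreserving.id volume)
  exact h4.comp (h3.comp (h2.comp h1))

theorem norm_sq_eq_splitLast {n : ℕ} (z : EuclideanSpace ℝ (Fin (n + 1))) :
    ‖z‖ ^ 2 = ‖(splitLast n z).1‖ ^ 2 + (splitLast n z).2 ^ 2 := by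
  simp [EuclideanSpace.norm_sq_eq, Fin.sum_univ_castSucc, splitLast_fst_apply, splitLast_snd]

theorem inner_boundaryEmbedding {n : ℕ} (z : EuclideanSpace ℝ (Fin (n + 1)))
    (x : EuclideanSpace ℝ (Fin n)) :
    ⟪z, boundaryEmbedding n x⟫ = ⟪(splitLast n z).1, x⟫ := by
  simp [PiLp.inner_apply, Fin.sum_univ_castSucc, splitLast_fst_apply, boundaryEmbedding]

/-- Restriction to `ρ = 0` of a Fourier transform is the Fourier transform of the integral over the
dual variable. -/
theorem fourier_boundaryEmbedding {n : ℕ} {Φ : EuclideanSpace ℝ (Fin (n + 1)) → ℂ}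
    (hΦ : Integrable Φ) (x : EuclideanSpace ℝ (Fin n)) :
    𝓕 Φ (boundaryEmbedding n x) = 𝓕 (fun ξ ↦ ∫ τ, Φ ((splitLast n).symm (ξ, τ))) x := by
  have hmp := (measurePreserving_splitLast n).symm
  rw [Real.fourier_eq, Real.fourier_eq, ← hmp.integral_comp', Measure.volume_eq_prod,
    integral_prod]
  -- The phase at (x, 0) does not depend on τ, so it comes out of the inner integral.
  · refine integral_congr_ae (Filter.Eventually.of_forall fun ξ ↦ ?_)
    simp only [inner_boundaryEmbedding, MeasurableEquiv.apply_symm_apply]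
    exact integral_const_mul _ _
  · have := (Real.fourierIntegral_convergent_iff (boundaryEmbedding n x)).2 hΦ
    exact (hmp.integrable_comp_emb (splitLast n).symm.measurableEmbedding).2 this

/-! ### Integral operators dominated by convolutions -/

theorem eLpNorm_two_sq {α F : Type*} [MeasurableSpace α] [NormedAddCommGroup F] (μ : Measure α)
    (f : α → F) : eLpNorm f 2 μ ^ 2 = ∫⁻ x, ‖f x‖ₑ ^ 2 ∂μ := by
  have h := eLpNorm_nnreal_pow_eq_lintegral (f := f) (μ := μ) (p := 2) two_ne_zero
  simpa using h

section
variable {E : Type*} [NormedAddCommGroup E] [InnerProductSpace ℝ E]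
    [MeasurableSpace E] [BorelSpace E] [FiniteDimensional ℝ E]
    {K : E → E → ℂ} {κ : E → ℝ≥0∞} {w v : E → ℂ}

theorem enorm_integral_kernel_le (hKκ : ∀ η ζ, ‖K η ζ‖ₑ ≤ κ (η - ζ)) (η : E) :
    ‖∫ ζ, K η ζ * w ζ‖ₑ ≤ ∫⁻ ζ, κ (η - ζ) * ‖w ζ‖ₑ := by
  refine (enorm_integral_le_lintegral_enorm _).trans (lintegral_mono fun ζ ↦ ?_)
  rw [enorm_mul]
  gcongr
  exact hKκ η ζ

theorem eLpNorm_integral_kernel_le (hκ : Measurable κ) (hKκ : ∀ η ζ, ‖K η ζ‖ₑ ≤ κ (η - ζ))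
    (hw : AEStronglyMeasurable w) :
    eLpNorm (fun η ↦ ∫ ζ, K η ζ * w ζ) 2 ≤ (∫⁻ θ, κ θ) * eLpNorm w 2 := by
  refine (ENNReal.pow_right_strictMono two_ne_zero).le_iff_le.1 ?_
  rw [mul_pow, eLpNorm_two_sq, eLpNorm_two_sq]
  refine (lintegral_mono fun η ↦ ?_).trans (lintegral_sq_convolution_le hκ hw.enorm)
  exact pow_le_pow_left₀ zero_le (enorm_integral_kernel_le hKκ η) 2

theorem aestronglyMeasurable_kernel_mul (hK : StronglyMeasurable (fun p : E × E ↦ K p.1 p.2))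
    (hw : AEStronglyMeasurable w) :
    AEStronglyMeasurable (fun p : E × E ↦ K p.1 p.2 * w p.2) ((volume : Measure E).prod volume) :=
  hK.aestronglyMeasurable.mul
    (hw.comp_quasiMeasurePreserving Measure.quasiMeasurePreserving_snd)

theorem memLp_integral_kernel (hK : StronglyMeasurable (fun p : E × E ↦ K p.1 p.2))
    (hκ : Measurable κ) (hκi : ∫⁻ θ, κ θ < ⊤) (hKκ : ∀ η ζ, ‖K η ζ‖ₑ ≤ κ (η - ζ))
    (hw : MemLp w 2) : MemLp (fun η ↦ ∫ ζ, K η ζ * w ζ) 2 :=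
  ⟨(aestronglyMeasurable_kernel_mul hK hw.1).integral_prod_right',
    (eLpNorm_integral_kernel_le hκ hKκ hw.1).trans_lt (ENNReal.mul_lt_top hκi hw.2)⟩

/-- Fubini applies because ∫ |v| (κ * |w|) ≤ ‖v‖₂ ‖κ‖₁ ‖w‖₂. This identity carries the duality
between the operator and its transpose. -/
theorem integral_mul_integral_kernel (hK : StronglyMeasurable (fun p : E × E ↦ K p.1 p.2))
    (hκ : Measurable κ) (hκi : ∫⁻ θ, κ θ < ⊤) (hKκ : ∀ η ζ, ‖K η ζ‖ₑ ≤ κ (η - ζ))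
    (hw : MemLp w 2) (hv : MemLp v 2) :
    ∫ η, v η * ∫ ζ, K η ζ * w ζ = ∫ ζ, (∫ η, v η * K η ζ) * w ζ := by
  have hm : AEStronglyMeasurable (fun p : E × E ↦ v p.1 * (K p.1 p.2 * w p.2))
      ((volume : Measure E).prod volume) :=
    (hv.1.comp_quasiMeasurePreserving Measure.quasiMeasurePreserving_fst).mul
      (aestronglyMeasurable_kernel_mul hK hw.1)
  have hm' : AEMeasurable (fun p : E × E ↦ κ (p.1 - p.2) * ‖w p.2‖ₑ)
      ((volume : Measure E).prod volume) :=
    (hκ.comp (measurable_fst.sub measurable_snd)).aemeasurable.mul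
      (hw.1.enorm.comp_quasiMeasurePreserving Measure.quasiMeasurePreserving_snd)
  have hi : Integrable (fun p : E × E ↦ v p.1 * (K p.1 p.2 * w p.2))
      ((volume : Measure E).prod volume) := by
    refine ⟨hm, ?_⟩
    rw [HasFiniteIntegral, lintegral_prod _ hm.enorm]
    have h1 : ∫⁻ η, ∫⁻ ζ, ‖v η * (K η ζ * w ζ)‖ₑ ≤
        ∫⁻ η, ‖v η‖ₑ * ∫⁻ ζ, κ (η - ζ) * ‖w ζ‖ₑ := by
      refine lintegral_mono fun η ↦ ?_
      have hη : AEMeasurable fun ζ ↦ κ (η - ζ) * ‖w ζ‖ₑ :=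
        (hκ.comp (measurable_const.sub measurable_id)).aemeasurable.mul hw.1.enorm
      rw [← lintegral_const_mul'' _ hη]
      refine lintegral_mono fun ζ ↦ ?_
      rw [enorm_mul, enorm_mul]
      gcongr
      exact hKκ η ζ
    refine h1.trans_lt ?_
    have h2 := sq_lintegral_mul_le volume hv.1.enorm hm'.lintegral_prod_right'
    have h3 := lintegral_sq_convolution_le hκ hw.1.enorm
    rw [← eLpNorm_two_sq] at h2 h3
    have h4 := h2.trans (mul_le_mul_right h3 _)
    have h5 : (∫⁻ η, ‖v η‖ₑ * ∫⁻ ζ, κ (η - ζ) * ‖w ζ‖ₑ) ^ 2 < ⊤ :=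
      h4.trans_lt (ENNReal.mul_lt_top (ENNReal.pow_lt_top hv.2)
        (ENNReal.mul_lt_top (ENNReal.pow_lt_top hκi) (ENNReal.pow_lt_top hw.2)))
    exact (ENNReal.pow_lt_top_iff.1 h5).resolve_right two_ne_zero
  calc ∫ η, v η * ∫ ζ, K η ζ * w ζ = ∫ η, ∫ ζ, v η * (K η ζ * w ζ) := by
        simp only [integral_const_mul]
    _ = ∫ ζ, ∫ η, v η * (K η ζ * w ζ) := integral_integral_swap hi
    _ = _ := by simp only [← mul_assoc, integral_mul_const]

end

/-! ### The kernel of a pseudodifferential operator on the Fourier side -/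

section
variable {E : Type} [NormedAddCommGroup E] [InnerProductSpace ℝ E]
  [MeasurableSpace E] [BorelSpace E] [FiniteDimensional ℝ E] {k : ℝ} (a : Symbol E k)

/-- The kernel `(η, ζ) ↦ ∫ exp (2πi x·(ζ - η)) χ(x) a(x, 2πζ) dx`. -/
noncomputable def freqKernel (χ : E → ℂ) (η ζ : E) : ℂ :=
  oscInt (fun x _ ↦ amp a χ x ((2 * Real.pi) • ζ)) ((2 * Real.pi) • (ζ - η))

/-- Leibniz' rule in x at fixed frequency. In contrast to `amp_bound`, the exact order `k` is kept,
which the sharp Sobolev estimate needs. -/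
theorem exists_iteratedFDeriv_amp_le {K : Set E} (hK : IsCompact K) {χ : E → ℂ}
    (hχ : ContDiff ℝ ∞ χ) (hs : ∀ x ∉ K, χ x = 0) (N : ℕ) : ∃ C : ℝ, 0 ≤ C ∧ ∀ i ≤ N, ∀ x ζ : E,
    ‖iteratedFDeriv ℝ i (fun y ↦ amp a χ y ζ) x‖ ≤ C * (1 + ‖ζ‖) ^ k := by
  obtain ⟨C, hC, hχC⟩ := exists_sup_bound hK hχ hs N
  have hA : ∀ p : ℕ, ∃ A : ℝ, 0 ≤ A ∧ ∀ x ∈ K, ∀ ζ,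
      ‖iteratedFDeriv ℝ p (fun y ↦ a.toFun y ζ) x‖ ≤ A * (1 + ‖ζ‖) ^ k := by
    intro p
    obtain ⟨A, hA⟩ := a.bound K hK p 0
    refine ⟨max A 0, le_max_right _ _, fun x hx ζ ↦ ?_⟩
    have h := hA x hx ζ
    rw [← LinearIsometryEquiv.norm_iteratedFDeriv_comp_left (𝕜 := ℝ)
      (continuousMultilinearCurryFin0 ℝ E ℂ).symm (fun y ↦ a.toFun y ζ) x p]
    rw [Nat.cast_zero, sub_zero] at h
    exact h.trans (mul_le_mul_of_nonneg_right (le_max_left _ _) (by positivity))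
  choose A hA0 hA using hA
  refine ⟨∑ i ∈ Finset.range (N + 1), ∑ p ∈ Finset.range (i + 1), (i.choose p : ℝ) * C * A (i - p),
    Finset.sum_nonneg fun i _ ↦ Finset.sum_nonneg fun p _ ↦ by have := hA0 (i - p); positivity, ?_⟩
  intro i hi x ζ
  have hsm : ContDiff ℝ ∞ (fun y ↦ a.toFun y ζ) := a.smooth.comp (contDiff_id.prodMk contDiff_const)
  have hsum : ∑ p ∈ Finset.range (i + 1), (i.choose p : ℝ) * C * A (i - p) ≤
      ∑ i ∈ Finset.range (N + 1), ∑ p ∈ Finset.range (i + 1), (i.choose p : ℝ) * C * A (i - p) :=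
    Finset.single_le_sum
      (f := fun i ↦ ∑ p ∈ Finset.range (i + 1), (i.choose p : ℝ) * C * A (i - p))
      (fun i _ ↦ Finset.sum_nonneg fun p _ ↦ by have := hA0 (i - p); positivity)
      (Finset.mem_range.2 (by omega))
  refine le_trans ?_ (mul_le_mul_of_nonneg_right hsum (by positivity))
  refine (norm_iteratedFDeriv_smul_le hχ hsm x (n := i) (mod_cast le_top)).trans ?_
  rw [Finset.sum_mul]
  refine Finset.sum_le_sum fun p hp ↦ ?_
  have hp' : p ≤ i := by have := Finset.mem_range.1 hp; omega
  have := hA0 (i - p)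
  by_cases hx : x ∈ K
  · rw [mul_assoc _ (A _)]
    exact mul_le_mul (mul_le_mul_of_nonneg_left (hχC p (hp'.trans hi) x) (Nat.cast_nonneg _))
      (hA _ x hx ζ) (norm_nonneg _) (by positivity)
  · rw [iteratedFDeriv_zero_off hK hs p x hx, norm_zero, mul_zero, zero_mul]
    positivity

/-- Freezing ζ makes the amplitude constant in the frequency variable of `oscInt`, so θ and ζ become
independent. The decay constant is linear in the amplitude bound, so the factor (1 + ‖ζ‖)^k passes
through unchanged. -/
theorem exists_pow_mul_oscInt_amp_le {K : Set E} (hK : IsCompact K) {χ : E → ℂ}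
    (hχ : ContDiff ℝ ∞ χ) (hs : ∀ x ∉ K, χ x = 0) (N : ℕ) : ∃ C : ℝ, 0 ≤ C ∧ ∀ θ ζ : E,
    ‖θ‖ ^ N * ‖oscInt (fun x _ ↦ amp a χ x ζ) θ‖ ≤ C * (1 + ‖ζ‖) ^ k := by
  obtain ⟨c, hc, h⟩ := oscInt_decay_zero hK ℂ N
  obtain ⟨C, hC, hA⟩ := exists_iteratedFDeriv_amp_le a hK hχ hs N
  refine ⟨c * C, by positivity, fun θ ζ ↦ ?_⟩
  have hsm : ContDiff ℝ ∞ (fun x ↦ amp a χ x ζ) :=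
    (contDiff_amp a hχ).comp (contDiff_id.prodMk contDiff_const)
  have hb := h 0 (fun x _ ↦ amp a χ x ζ) (hsm.comp contDiff_fst)
    (fun x hx _ ↦ amp_supp a hs x hx ζ) (C * (1 + ‖ζ‖) ^ k) (by positivity) ?_ θ
  · rwa [pow_zero, mul_one, ← mul_assoc] at hb
  intro i hi j hj x ξ
  rw [pow_zero, mul_one]
  rcases j with _ | j
  · have e := LinearIsometryEquiv.norm_iteratedFDeriv_comp_left (𝕜 := ℝ)
      (continuousMultilinearCurryFin0 ℝ E ℂ).symm (fun y ↦ amp a χ y ζ) x i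
    exact e.trans_le (hA i hi x ζ)
  · have : (fun y ↦ iteratedFDeriv ℝ (j + 1) (fun _ : E ↦ amp a χ y ζ) ξ) = fun _ ↦ 0 :=
      funext fun y ↦ by rw [iteratedFDeriv_succ_const]; rfl
    rw [this]
    -- The zero function vanishes off the empty set, so its derivatives vanish everywhere.
    rw [iteratedFDeriv_zero_off isCompact_empty (fun _ _ ↦ rfl) i x (Set.notMem_empty x), norm_zero]
    positivity

/-- The decay estimates of orders 0 and 2M combine through (1 + t)^M ≤ 2^(M-1) (1 + t^M) with t = ‖η
- ζ‖². The dilations by 2π only help, since 2π ≥ 1 and k ≤ 0. -/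
theorem exists_freqKernel_le (hk : k ≤ 0) {K : Set E} (hK : IsCompact K) {χ : E → ℂ}
    (hχ : ContDiff ℝ ∞ χ) (hs : ∀ x ∉ K, χ x = 0) (M : ℕ) : ∃ C : ℝ, 0 ≤ C ∧ ∀ η ζ : E,
    ‖freqKernel a χ η ζ‖ ≤ C * (1 + ‖η - ζ‖ ^ 2) ^ (-(M : ℝ)) * (1 + ‖ζ‖ ^ 2) ^ (k / 2) := by
  obtain ⟨C0, hC0, h0⟩ := exists_pow_mul_oscInt_amp_le a hK hχ hs 0
  obtain ⟨C1, hC1, h1⟩ := exists_pow_mul_oscInt_amp_le a hK hχ hs (2 * M)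
  refine ⟨2 ^ (M - 1) * (C0 + C1), by positivity, fun η ζ ↦ ?_⟩
  have e0 := h0 ((2 * Real.pi) • (ζ - η)) ((2 * Real.pi) • ζ)
  have e1 := h1 ((2 * Real.pi) • (ζ - η)) ((2 * Real.pi) • ζ)
  change _ * ‖freqKernel a χ η ζ‖ ≤ _ at e0 e1
  have hpi : 1 ≤ 2 * Real.pi := by linarith [Real.pi_gt_three]
  have hz : (1 + ‖(2 * Real.pi) • ζ‖) ^ k ≤ (1 + ‖ζ‖ ^ 2) ^ (k / 2) := by
    rw [norm_smul, Real.norm_of_nonneg (by positivity)]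
    exact one_add_mul_rpow_le hk hpi (norm_nonneg _)
  have hθ : ‖η - ζ‖ ≤ ‖(2 * Real.pi) • (ζ - η)‖ := by
    rw [norm_smul, Real.norm_of_nonneg (by positivity), norm_sub_rev]
    exact le_mul_of_one_le_left (norm_nonneg _) hpi
  have key : (1 + ‖η - ζ‖ ^ 2) ^ M * ‖freqKernel a χ η ζ‖ ≤
      2 ^ (M - 1) * (C0 + C1) * (1 + ‖ζ‖ ^ 2) ^ (k / 2) := by
    calc (1 + ‖η - ζ‖ ^ 2) ^ M * ‖freqKernel a χ η ζ‖
        ≤ 2 ^ (M - 1) * (1 ^ M + (‖η - ζ‖ ^ 2) ^ M) * ‖freqKernel a χ η ζ‖ := by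
          gcongr
          exact add_pow_le zero_le_one (by positivity) _
      _ = 2 ^ (M - 1) * (‖η - ζ‖ ^ 0 * ‖freqKernel a χ η ζ‖ +
            ‖η - ζ‖ ^ (2 * M) * ‖freqKernel a χ η ζ‖) := by
          rw [one_pow, pow_zero, ← pow_mul]; ring
      _ ≤ 2 ^ (M - 1) * (C0 * (1 + ‖ζ‖ ^ 2) ^ (k / 2) + C1 * (1 + ‖ζ‖ ^ 2) ^ (k / 2)) := by
          refine mul_le_mul_of_nonneg_left (add_le_add ?_ ?_) (by positivity)
          · rw [pow_zero] at e0 ⊢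
            exact e0.trans (mul_le_mul_of_nonneg_left hz hC0)
          · refine le_trans ?_ (e1.trans (mul_le_mul_of_nonneg_left hz hC1))
            gcongr
      _ = _ := by ring
  rw [Real.rpow_neg (by positivity), Real.rpow_natCast, mul_right_comm, ← div_eq_mul_inv,
    le_div_iff₀ (by positivity), mul_comm]
  exact key

theorem stronglyMeasurable_freqKernel {χ : E → ℂ} (hχ : ContDiff ℝ ∞ χ) :
    StronglyMeasurable (fun p : E × E ↦ freqKernel a χ p.1 p.2) := by
  unfold freqKernel oscInt
  have hc := (contDiff_amp a hχ).continuous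
  have : Continuous (fun q : (E × E) × E ↦
      Complex.exp (Complex.I * (⟪q.2, (2 * Real.pi) • (q.1.2 - q.1.1)⟫ : ℝ)) •
        amp a χ q.2 ((2 * Real.pi) • q.1.2)) := by
    refine Continuous.smul (f := fun q : (E × E) × E ↦
      Complex.exp (Complex.I * (⟪q.2, (2 * Real.pi) • (q.1.2 - q.1.1)⟫ : ℝ))) (by fun_prop) ?_
    exact hc.comp (by fun_prop : Continuous fun q : (E × E) × E ↦ (q.2, (2 * Real.pi) • q.1.2))
  exact this.stronglyMeasurable.integral_prod_right'

/-- The kernel with the weights that turn the mapping property between Sobolev spaces into one on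
`L²`. -/
noncomputable def weightedKernel (χ : E → ℂ) (s : ℝ) (η ζ : E) : ℂ :=
  ((1 + ‖η‖ ^ 2) ^ (s / 2) : ℝ) * (freqKernel a χ η ζ * ((1 + ‖ζ‖ ^ 2) ^ (-(s + k) / 2) : ℝ))

theorem stronglyMeasurable_weightedKernel {χ : E → ℂ} (hχ : ContDiff ℝ ∞ χ) (s : ℝ) :
    StronglyMeasurable (fun p : E × E ↦ weightedKernel a χ s p.1 p.2) := by
  unfold weightedKernel
  refine StronglyMeasurable.mul ?_ ((stronglyMeasurable_freqKernel a hχ).mul ?_)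
  · exact Measurable.stronglyMeasurable (by fun_prop)
  · exact Measurable.stronglyMeasurable (by fun_prop)

/-- Peetre's inequality replaces the weight in η by one in ζ at the cost of (1 + |η - ζ|²)^(|s|/2).
The powers of 1 + |ζ|² then cancel, and the rapid decay in η - ζ pays the cost. -/
theorem exists_weightedKernel_le (hk : k ≤ 0) {K : Set E} (hK : IsCompact K) {χ : E → ℂ}
    (hχ : ContDiff ℝ ∞ χ) (hs : ∀ x ∉ K, χ x = 0) (s : ℝ) : ∃ κ : E → ℝ≥0∞, Measurable κ ∧
    ∫⁻ θ, κ θ < ⊤ ∧ ∀ η ζ, ‖weightedKernel a χ s η ζ‖ₑ ≤ κ (η - ζ) := by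
  -- This makes 2M - |s| exceed the dimension, so the dominating function is integrable.
  obtain ⟨M, hM⟩ := exists_nat_gt ((Module.finrank ℝ E + |s|) / 2)
  obtain ⟨C, hC, h⟩ := exists_freqKernel_le a hk hK hχ hs M
  have hint := (integrable_rpow_neg_one_add_norm_sq (E := E) (μ := volume) (r := 2 * M - |s|)
    (by linarith)).const_mul (2 ^ |s / 2| * C)
  refine ⟨fun θ ↦ ENNReal.ofReal (2 ^ |s / 2| * C * (1 + ‖θ‖ ^ 2) ^ (-(2 * M - |s|) / 2)),
    by fun_prop, hint.lintegral_lt_top, fun η ζ ↦ ?_⟩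
  rw [← ofReal_norm]
  refine ENNReal.ofReal_le_ofReal ?_
  have hζ : 0 < 1 + ‖ζ‖ ^ 2 := by positivity
  have hd : 0 < 1 + ‖η - ζ‖ ^ 2 := by positivity
  rw [weightedKernel, norm_mul, norm_mul, Complex.norm_real, Complex.norm_real,
    Real.norm_of_nonneg (by positivity), Real.norm_of_nonneg (by positivity)]
  calc _ ≤ (2 ^ |s / 2| * (1 + ‖η - ζ‖ ^ 2) ^ |s / 2| * (1 + ‖ζ‖ ^ 2) ^ (s / 2)) *
        ((C * (1 + ‖η - ζ‖ ^ 2) ^ (-(M : ℝ)) * (1 + ‖ζ‖ ^ 2) ^ (k / 2)) *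
          (1 + ‖ζ‖ ^ 2) ^ (-(s + k) / 2)) := by
        gcongr
        · exact peetre _ _ _
        · exact h η ζ
    _ = 2 ^ |s / 2| * C * ((1 + ‖η - ζ‖ ^ 2) ^ |s / 2| * (1 + ‖η - ζ‖ ^ 2) ^ (-(M : ℝ))) *
        ((1 + ‖ζ‖ ^ 2) ^ (s / 2) * (1 + ‖ζ‖ ^ 2) ^ (k / 2) * (1 + ‖ζ‖ ^ 2) ^ (-(s + k) / 2)) := by
        ring
    _ = _ := by
        rw [← Real.rpow_add hd, ← Real.rpow_add hζ, ← Real.rpow_add hζ,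
          show s / 2 + k / 2 + -(s + k) / 2 = 0 by ring, Real.rpow_zero, mul_one, abs_div,
          abs_two]
        congr 2
        ring

/-- The multiplication formula ∫ (𝓕 ψ) F = ∫ ψ (𝓕 F), with F the product of f and a character; the
modulation shifts the frequency by ζ. -/
theorem oscillatory_integral_fourier_eq {f ψ : E → ℂ} (hf : Integrable f) (hψ : Integrable ψ)
    (ζ : E) : ∫ x, Complex.exp (Complex.I * (⟪x, (2 * Real.pi) • ζ⟫ : ℝ)) * (𝓕 ψ x * f x) =
      ∫ η, ψ η * oscInt (fun x _ ↦ f x) ((2 * Real.pi) • (ζ - η)) := by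
  set e : E → ℂ := fun x ↦ Complex.exp (Complex.I * (⟪x, (2 * Real.pi) • ζ⟫ : ℝ)) with he
  have hef : Integrable (fun x ↦ e x * f x) := by
    refine hf.bdd_mul (c := 1) (by fun_prop) (Filter.Eventually.of_forall fun x ↦ ?_)
    simp only [he]
    rw [mul_comm Complex.I, Complex.norm_exp_ofReal_mul_I]
  have h := VectorFourier.integral_fourierIntegral_smul_eq_flip (μ := volume) (ν := volume)
    (L := innerₗ E) Real.continuous_fourierChar continuous_inner hψ hef
  simp only [smul_eq_mul] at h
  calc _ = ∫ x, 𝓕 ψ x * (e x * f x) := by congr 1; funext x; ring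
    _ = _ := h
    _ = _ := by
      congr 1
      funext η
      congr 1
      unfold oscInt VectorFourier.fourierIntegral
      congr 1
      funext x
      simp only [he, LinearMap.flip_apply, innerₗ_apply_apply, Circle.smul_def, smul_eq_mul,
        Real.fourierChar_apply, ← mul_assoc, ← Complex.exp_add]
      congr 2
      rw [inner_smul_right, inner_smul_right, inner_sub_right, real_inner_comm x η]
      push_cast
      ring

end

/-! ### Boundary layers on the Fourier side -/

theorem splitLast_symm_eq {n : ℕ} (ξ : EuclideanSpace ℝ (Fin n)) (τ : ℝ) :
    (splitLast n).symm (ξ, τ) =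
      boundaryEmbedding n ξ + EuclideanSpace.single (Fin.last n) τ := by
  rw [MeasurableEquiv.symm_apply_eq]
  refine Prod.ext (PiLp.ext fun i ↦ ?_) ?_
  · simp [splitLast_fst_apply, boundaryEmbedding, Fin.castSucc_ne_last]
  · simp [splitLast_snd, boundaryEmbedding]

/-- Schwartz decay gives the majorant C (1 + τ²)⁻¹ uniformly in ξ. Continuity is what makes Fourier
inversion hold at every point. -/
theorem continuous_integral_last {n : ℕ} (Φ : 𝓢(EuclideanSpace ℝ (Fin (n + 1)), ℂ)) :
    Continuous (fun ξ ↦ ∫ τ : ℝ, Φ ((splitLast n).symm (ξ, τ))) := by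
  obtain ⟨C0, -, h0⟩ := Φ.decay 0 0
  obtain ⟨C2, -, h2⟩ := Φ.decay 2 0
  simp only [norm_iteratedFDeriv_zero] at h0 h2
  refine continuous_of_dominated (bound := fun τ ↦ (C0 + C2) * (1 + τ ^ 2)⁻¹) (fun ξ ↦ ?_)
    (fun ξ ↦ ?_) (integrable_inv_one_add_sq.const_mul _) ?_
  · exact (Φ.continuous.measurable.comp ((splitLast n).symm.measurable.comp
      (measurable_const.prodMk measurable_id))).aestronglyMeasurable
  · refine Filter.Eventually.of_forall fun τ ↦ ?_
    rw [← div_eq_mul_inv, le_div_iff₀ (by positivity)]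
    have e0 := h0 ((splitLast n).symm (ξ, τ))
    have e2 := h2 ((splitLast n).symm (ξ, τ))
    rw [norm_sq_eq_splitLast, MeasurableEquiv.apply_symm_apply] at e2
    rw [pow_zero, one_mul] at e0
    have := mul_nonneg (sq_nonneg ‖ξ‖) (norm_nonneg (Φ ((splitLast n).symm (ξ, τ))))
    simp only at e2
    nlinarith
  · refine Filter.Eventually.of_forall fun τ ↦ ?_
    simp only [splitLast_symm_eq]
    exact Φ.continuous.comp ((boundaryEmbedding n).continuous.add continuous_const)

/-- The Fourier transform of g ⊗ δ is (𝓕 g) ⊗ 1, so pairing with Φ integrates out τ. Taking Θ as the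
inverse transform of the restriction of 𝓕 Φ to ρ = 0 makes it Schwartz by construction; Fourier
inversion gives the formula. -/
theorem fourier_boundaryLayer_apply {n : ℕ} (g : 𝓢'(EuclideanSpace ℝ (Fin n), ℂ))
    (Φ : 𝓢(EuclideanSpace ℝ (Fin (n + 1)), ℂ)) : ∃ Θ : 𝓢(EuclideanSpace ℝ (Fin n), ℂ),
    (∀ ξ, Θ ξ = ∫ τ : ℝ, Φ ((splitLast n).symm (ξ, τ))) ∧
      𝓕 (boundaryLayer n g) Φ = (𝓕 g) Θ := by
  set R : 𝓢(EuclideanSpace ℝ (Fin n), ℂ) := SchwartzMap.compCLMOfAntilipschitz ℂ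
      (boundaryEmbedding n).toContinuousLinearMap.hasTemperateGrowth
      (boundaryEmbedding n).antilipschitz (𝓕 Φ) with hR
  have hi : Integrable (fun ξ ↦ ∫ τ : ℝ, Φ ((splitLast n).symm (ξ, τ))) := by
    have h := ((measurePreserving_splitLast n).symm.integrable_comp_emb
      (splitLast n).symm.measurableEmbedding).2 Φ.integrable
    exact h.integral_prod_left
  have hF : 𝓕 (fun ξ ↦ ∫ τ : ℝ, Φ ((splitLast n).symm (ξ, τ))) = R := by
    funext x
    exact (fourier_boundaryEmbedding Φ.integrable x).symm
  refine ⟨𝓕⁻ R, fun ξ ↦ ?_, ?_⟩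
  · rw [SchwartzMap.fourierInv_coe, ← hF, (continuous_integral_last Φ).fourierInv_fourier_eq hi]
    rw [hF]
    exact R.integrable
  · rw [TemperedDistribution.fourier_apply, TemperedDistribution.fourier_apply,
      FourierTransform.fourier_fourierInv_eq]
    rfl

/-- A distribution in a Sobolev space acts through a weighted `L²` function on the Fourier side. -/
theorem fourier_apply_of_besselPotential_eq {E : Type*} [NormedAddCommGroup E]
    [InnerProductSpace ℝ E] [FiniteDimensional ℝ E] [MeasurableSpace E] [BorelSpace E] {s : ℝ}
    {u : 𝓢'(E, ℂ)} {f : Lp ℂ 2 (volume : Measure E)}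
    (h : TemperedDistribution.besselPotential E ℂ s u = (f : 𝓢'(E, ℂ))) (Θ : 𝓢(E, ℂ)) :
    (𝓕 u) Θ = ∫ ξ, (((1 + ‖ξ‖ ^ 2) ^ (-s / 2) : ℝ) * Θ ξ) * (𝓕 f : Lp ℂ 2 (volume : Measure E)) ξ := by
  have h1 : u = TemperedDistribution.besselPotential E ℂ (-s) (f : 𝓢'(E, ℂ)) :=
    ((TemperedDistribution.besselPotential_neg_apply_eq_iff s _ _).2 h).symm
  rw [h1, TemperedDistribution.fourier_besselPotential_eq_smulLeftCLM_fourier_apply,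
    Lp.fourier_toTemperedDistribution_eq, TemperedDistribution.smulLeftCLM_apply_apply,
    Lp.toTemperedDistribution_apply]
  refine integral_congr_ae (Filter.Eventually.of_forall fun ξ ↦ ?_)
  simp only [smul_eq_mul]
  rw [SchwartzMap.smulLeftCLM_apply_apply (by fun_prop), smul_eq_mul]

/-- The function `(1 + |(ξ, τ)|²)^(m/2) (1 + |ξ|²)^(-(m + 1/2)/2) f(ξ)` of `(ξ, τ)`. -/
noncomputable def layerLift (n : ℕ) (m : ℝ) (f : EuclideanSpace ℝ (Fin n) → ℂ)
    (z : EuclideanSpace ℝ (Fin (n + 1))) : ℂ :=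
  (((1 + ‖z‖ ^ 2) ^ (m / 2) * (1 + ‖(splitLast n z).1‖ ^ 2) ^ (-(m + 1 / 2) / 2) : ℝ) : ℂ) *
    f (splitLast n z).1

theorem aestronglyMeasurable_layerLift {n : ℕ} (m : ℝ) {f : EuclideanSpace ℝ (Fin n) → ℂ}
    (hf : AEStronglyMeasurable f) : AEStronglyMeasurable (layerLift n m f) := by
  have h1 : Measurable fun z ↦ (splitLast n z).1 := measurable_fst.comp (splitLast n).measurable
  refine AEStronglyMeasurable.mul ?_ ?_
  · exact Measurable.aestronglyMeasurable (by fun_prop)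
  · exact hf.comp_quasiMeasurePreserving (Measure.quasiMeasurePreserving_fst.comp
      (measurePreserving_splitLast n).quasiMeasurePreserving)

/-- The τ-integral at fixed ξ produces (1 + |ξ|²)^(m+1/2), which the weight in `layerLift` cancels
exactly. Thus the lift is an L² isometry up to a constant, possibly infinite. -/
theorem lintegral_layerLift_sq {n : ℕ} (m : ℝ) {f : EuclideanSpace ℝ (Fin n) → ℂ}
    (hf : AEStronglyMeasurable f) : ∫⁻ z, ‖layerLift n m f z‖ₑ ^ 2 =
      (∫⁻ τ : ℝ, ENNReal.ofReal ((1 + τ ^ 2) ^ m)) * ∫⁻ ξ, ‖f ξ‖ₑ ^ 2 := by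
  have hmp := (measurePreserving_splitLast n).symm
  have hm := (aestronglyMeasurable_layerLift m hf).enorm.pow_const 2
  have hm' : AEMeasurable (fun p ↦ ‖layerLift n m f ((splitLast n).symm p)‖ₑ ^ 2)
      ((volume : Measure (EuclideanSpace ℝ (Fin n))).prod (volume : Measure ℝ)) :=
    hm.comp_quasiMeasurePreserving hmp.quasiMeasurePreserving
  rw [← hmp.lintegral_comp_emb (splitLast n).symm.measurableEmbedding, Measure.volume_eq_prod,
    lintegral_prod _ hm',
    ← lintegral_const_mul'' _ (hf.enorm.pow_const 2)]
  refine lintegral_congr fun ξ ↦ ?_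
  have hA : 0 < 1 + ‖ξ‖ ^ 2 := by positivity
  have e : ∀ τ : ℝ, ‖layerLift n m f ((splitLast n).symm (ξ, τ))‖ₑ ^ 2 =
      ENNReal.ofReal ((1 + ‖ξ‖ ^ 2) ^ (-(m + 1 / 2))) * ‖f ξ‖ₑ ^ 2 *
        ENNReal.ofReal ((1 + ‖ξ‖ ^ 2 + τ ^ 2) ^ m) := fun τ ↦ by
    have hB : 0 ≤ 1 + ‖ξ‖ ^ 2 + τ ^ 2 := by positivity
    rw [layerLift, norm_sq_eq_splitLast, MeasurableEquiv.apply_symm_apply, enorm_mul, mul_pow,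
      ← ofReal_norm (Complex.ofReal _), Complex.norm_real, Real.norm_of_nonneg (by positivity),
      ← ENNReal.ofReal_pow (by positivity), mul_pow, ← Real.rpow_mul_natCast (by positivity),
      ← Real.rpow_mul_natCast (by positivity), ENNReal.ofReal_mul (by positivity), ← add_assoc,
      Nat.cast_ofNat, div_mul_cancel₀ _ two_ne_zero, div_mul_cancel₀ _ two_ne_zero]
    ring
  simp only [e]
  rw [lintegral_const_mul _ (by fun_prop), lintegral_add_sq_rpow m hA, mul_mul_mul_comm,
    ← ENNReal.ofReal_mul (by positivity), ← Real.rpow_add hA, neg_add_cancel, Real.rpow_zero,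
    ENNReal.ofReal_one, one_mul, mul_comm]

theorem exists_eLpNorm_layerLift_le (n : ℕ) {m : ℝ} (hm : m < -1 / 2) : ∃ c : ℝ≥0,
    ∀ f : EuclideanSpace ℝ (Fin n) → ℂ, AEStronglyMeasurable f →
      eLpNorm (layerLift n m f) 2 ≤ c * eLpNorm f 2 := by
  have hc := lintegral_one_add_sq_rpow_lt_top hm
  -- The sharp constant is the square root of the integral; the integral plus 1 avoids the root,
  -- since c ≤ (c + 1)².
  refine ⟨(∫⁻ τ : ℝ, ENNReal.ofReal ((1 + τ ^ 2) ^ m)).toNNReal + 1, fun f hf ↦ ?_⟩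
  refine (ENNReal.pow_right_strictMono two_ne_zero).le_iff_le.1 ?_
  rw [mul_pow, eLpNorm_two_sq, eLpNorm_two_sq, lintegral_layerLift_sq m hf, ENNReal.coe_add,
    ENNReal.coe_toNNReal hc.ne, ENNReal.coe_one]
  gcongr
  set c := ∫⁻ τ : ℝ, ENNReal.ofReal ((1 + τ ^ 2) ^ m)
  calc c ≤ c + 1 := le_self_add
    _ ≤ (c + 1) ^ 2 := le_self_pow₀ le_add_self two_ne_zero

theorem memLp_layerLift {n : ℕ} {m : ℝ} (hm : m < -1 / 2) {f : EuclideanSpace ℝ (Fin n) → ℂ}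
    (hf : MemLp f 2) : MemLp (layerLift n m f) 2 := by
  obtain ⟨c, hc⟩ := exists_eLpNorm_layerLift_le n hm
  exact ⟨aestronglyMeasurable_layerLift m hf.1,
    (hc f hf.1).trans_lt (ENNReal.mul_lt_top ENNReal.coe_lt_top hf.2)⟩

theorem memLp_rpow_mul_schwartz {E : Type*} [NormedAddCommGroup E]
    [InnerProductSpace ℝ E] [FiniteDimensional ℝ E] [MeasurableSpace E] [BorelSpace E] (r : ℝ)
    (Φ : 𝓢(E, ℂ)) : MemLp (fun z ↦ ((1 + ‖z‖ ^ 2) ^ r : ℝ) * Φ z) 2 := by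
  refine (memLp_congr_ae (Filter.Eventually.of_forall fun z ↦ ?_)).1
    ((SchwartzMap.smulLeftCLM ℂ (fun z : E ↦ (((1 + ‖z‖ ^ 2) ^ r : ℝ) : ℂ)) Φ).memLp 2)
  rw [SchwartzMap.smulLeftCLM_apply_apply (by fun_prop), smul_eq_mul]

/-- This says that the layer belongs to W^m: `layerLift` of 𝓕 f is (1 + |z|²)^(m/2) times its
Fourier transform, and it is in L². -/
theorem fourier_boundaryLayer_eq_integral {n : ℕ} {m : ℝ} (hm : m < -1 / 2)
    {g : 𝓢'(EuclideanSpace ℝ (Fin n), ℂ)} {f : Lp ℂ 2 (volume : Measure (EuclideanSpace ℝ (Fin n)))}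
    (h : TemperedDistribution.besselPotential _ ℂ (m + 1 / 2) g =
      (f : 𝓢'(EuclideanSpace ℝ (Fin n), ℂ)))
    (Φ : 𝓢(EuclideanSpace ℝ (Fin (n + 1)), ℂ)) :
    𝓕 (boundaryLayer n g) Φ = ∫ z, (((1 + ‖z‖ ^ 2) ^ (-m / 2) : ℝ) * Φ z) *
      layerLift n m (𝓕 f : Lp ℂ 2 (volume : Measure (EuclideanSpace ℝ (Fin n)))) z := by
  obtain ⟨Θ, hΘ, hΘ'⟩ := fourier_boundaryLayer_apply g Φ
  set W : Lp ℂ 2 (volume : Measure (EuclideanSpace ℝ (Fin n))) := 𝓕 f with hW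
  have hmp := (measurePreserving_splitLast n).symm
  have hint : Integrable (fun z ↦ (((1 + ‖z‖ ^ 2) ^ (-m / 2) : ℝ) * Φ z) * layerLift n m W z) :=
    (memLp_rpow_mul_schwartz (-m / 2) Φ).integrable_mul (memLp_layerLift hm (Lp.memLp W))
  have hint' : Integrable (fun p ↦ (((1 + ‖(splitLast n).symm p‖ ^ 2) ^ (-m / 2) : ℝ) *
      Φ ((splitLast n).symm p)) * layerLift n m W ((splitLast n).symm p))
      ((volume : Measure (EuclideanSpace ℝ (Fin n))).prod (volume : Measure ℝ)) :=
    (hmp.integrable_comp_emb (splitLast n).symm.measurableEmbedding).2 hint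
  rw [hΘ', fourier_apply_of_besselPotential_eq h, ← hmp.integral_comp', Measure.volume_eq_prod,
    integral_prod _ hint']
  refine integral_congr_ae (Filter.Eventually.of_forall fun ξ ↦ ?_)
  simp only
  rw [hΘ, ← integral_const_mul, ← integral_mul_const]
  refine integral_congr_ae (Filter.Eventually.of_forall fun τ ↦ ?_)
  set z := (splitLast n).symm (ξ, τ) with hz
  have hξ : (splitLast n z).1 = ξ := by rw [hz, MeasurableEquiv.apply_symm_apply]
  have e : (1 + ‖z‖ ^ 2) ^ (-m / 2) * (1 + ‖z‖ ^ 2) ^ (m / 2) = 1 := by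
    rw [← Real.rpow_add (by positivity), neg_div, neg_add_cancel, Real.rpow_zero]
  have e' : (((1 + ‖z‖ ^ 2) ^ (-m / 2) : ℝ) : ℂ) * ((1 + ‖z‖ ^ 2) ^ (m / 2) : ℝ) = 1 := mod_cast e
  simp only [layerLift, hξ, Complex.ofReal_mul, ← hz]
  linear_combination (-(Φ z * ((1 + ‖ξ‖ ^ 2) ^ (-(m + 1 / 2) / 2) : ℝ) * W ξ)) * e'

/-! ### The action on test functions -/

section
variable {E : Type} [NormedAddCommGroup E] [InnerProductSpace ℝ E]
  [MeasurableSpace E] [BorelSpace E] [FiniteDimensional ℝ E] {k : ℝ} (a : Symbol E k)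

/-- Because χ = 1 on the support of φ, the cutoff may be inserted into the symbol. Writing φ as the
Fourier transform of 𝓕⁻ φ then brings in the kernel. -/
theorem transpose_apply_eq_integral_freqKernel {χ : E → ℂ} (hχ : ContDiff ℝ ∞ χ)
    (hχs : HasCompactSupport χ) (φ : 𝓓((⊤ : TopologicalSpace.Opens E), ℂ))
    (h1 : ∀ x ∈ tsupport φ, χ x = 1) (ζ : E) : a.transpose φ ζ =
      ∫ η, (𝓕⁻ (φ.hasCompactSupport.toSchwartzMap φ.contDiff)) η * freqKernel a χ η ζ := by
  set φ' := φ.hasCompactSupport.toSchwartzMap φ.contDiff with hφ'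
  have hsm : ContDiff ℝ ∞ (fun x ↦ amp a χ x ((2 * Real.pi) • ζ)) :=
    (contDiff_amp a hχ).comp (contDiff_id.prodMk contDiff_const)
  have hi : Integrable (fun x ↦ amp a χ x ((2 * Real.pi) • ζ)) :=
    hsm.continuous.integrable_of_hasCompactSupport
      (HasCompactSupport.intro hχs fun x hx ↦
        amp_supp a (fun y hy ↦ image_eq_zero_of_notMem_tsupport hy) x hx _)
  have h := oscillatory_integral_fourier_eq hi (𝓕⁻ φ').integrable ζ
  rw [← SchwartzMap.fourier_coe, FourierTransform.fourier_fourierInv_eq] at h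
  rw [Symbol.transpose_apply]
  refine Eq.trans ?_ h
  refine integral_congr_ae (Filter.Eventually.of_forall fun x ↦ ?_)
  simp only
  congr 1
  change φ x * _ = φ x * (χ x * _)
  by_cases hx : x ∈ tsupport φ
  · rw [h1 x hx, one_mul]
  · rw [image_eq_zero_of_notMem_tsupport hx, zero_mul, zero_mul]

theorem rpow_mul_transpose_apply {χ : E → ℂ} (hχ : ContDiff ℝ ∞ χ)
    (hχs : HasCompactSupport χ) (φ : 𝓓((⊤ : TopologicalSpace.Opens E), ℂ))
    (h1 : ∀ x ∈ tsupport φ, χ x = 1) (s : ℝ) (ζ : E) :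
    ((1 + ‖ζ‖ ^ 2) ^ (-(s + k) / 2) : ℝ) * a.transpose φ ζ =
      ∫ η, (((1 + ‖η‖ ^ 2) ^ (-s / 2) : ℝ) *
        (𝓕⁻ (φ.hasCompactSupport.toSchwartzMap φ.contDiff)) η) * weightedKernel a χ s η ζ := by
  rw [transpose_apply_eq_integral_freqKernel a hχ hχs φ h1, ← integral_const_mul]
  refine integral_congr_ae (Filter.Eventually.of_forall fun η ↦ ?_)
  have e : (1 + ‖η‖ ^ 2) ^ (-s / 2) * (1 + ‖η‖ ^ 2) ^ (s / 2) = 1 := by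
    rw [← Real.rpow_add (by positivity), neg_div, neg_add_cancel, Real.rpow_zero]
  have e' : (((1 + ‖η‖ ^ 2) ^ (-s / 2) : ℝ) : ℂ) * ((1 + ‖η‖ ^ 2) ^ (s / 2) : ℝ) = 1 := mod_cast e
  simp only [weightedKernel]
  linear_combination (-((𝓕⁻ (φ.hasCompactSupport.toSchwartzMap φ.contDiff)) η *
    freqKernel a χ η ζ * ((1 + ‖ζ‖ ^ 2) ^ (-(s + k) / 2) : ℝ))) * e'

/-- The witness is the distribution with Fourier transform (1 + |η|²)^(-s/2) F; Plancherel gives the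
norm. -/
theorem exists_sobolevNorm_le (s : ℝ) (F : Lp ℂ 2 (volume : Measure E)) : ∃ U : 𝓢'(E, ℂ),
    sobolevNorm s U ≤ ‖F‖ₑ ∧
      ∀ φ : 𝓢(E, ℂ), U φ = ∫ η, (((1 + ‖η‖ ^ 2) ^ (-s / 2) : ℝ) * (𝓕⁻ φ) η) * F η := by
  set f : Lp ℂ 2 (volume : Measure E) := 𝓕⁻ F with hf
  have hF : 𝓕 f = F := FourierTransform.fourier_fourierInv_eq F
  have hU : TemperedDistribution.besselPotential E ℂ s
      (TemperedDistribution.besselPotential E ℂ (-s) (f : 𝓢'(E, ℂ))) = (f : 𝓢'(E, ℂ)) := by simp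
  refine ⟨_, (iInf₂_le f hU).trans_eq ?_, fun φ ↦ ?_⟩
  · rw [← hF, ← ofReal_norm, ← ofReal_norm, Lp.norm_fourier_eq]
  · have h := fourier_apply_of_besselPotential_eq hU (𝓕⁻ φ)
    rwa [TemperedDistribution.fourier_apply, FourierTransform.fourier_fourierInv_eq, hF] at h

end

theorem exists_cutoff {E : Type*} [NormedAddCommGroup E] [InnerProductSpace ℝ E]
    [FiniteDimensional ℝ E] {V : Set E} (hV : Bornology.IsBounded V) :
    ∃ χ : E → ℂ, ContDiff ℝ ∞ χ ∧ HasCompactSupport χ ∧ ∀ x ∈ V, χ x = 1 := by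
  obtain ⟨R, hR, hVR⟩ := hV.subset_closedBall_lt 0 0
  let b : ContDiffBump (0 : E) := ⟨R, R + 1, hR, by linarith⟩
  refine ⟨fun x ↦ (b x : ℂ), Complex.ofRealCLM.contDiff.comp b.contDiff,
    b.hasCompactSupport.comp_left Complex.ofReal_zero, fun x hx ↦ ?_⟩
  simp only
  rw [b.one_of_mem_closedBall (hVR hx), Complex.ofReal_one]

end PsiDO

/-! ### The estimate near the boundary -/

theorem mainTheorem3 (n : ℕ) (k s : ℝ) (hk : k ≤ -1) (hs : s ≤ |k| - 1)
    (A : 𝓢'(EuclideanSpace ℝ (Fin (n + 1)), ℂ) →L[ℂ]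
      PsiDO.Distr (EuclideanSpace ℝ (Fin (n + 1))))
    (hA : A ∈ PsiDO.PseudoDiffOp (EuclideanSpace ℝ (Fin (n + 1))) k)
    (V : TopologicalSpace.Opens (EuclideanSpace ℝ (Fin (n + 1))))
    (hV : Bornology.IsBounded (V : Set (EuclideanSpace ℝ (Fin (n + 1))))) :
    ∃ C : ℝ≥0, ∀ g_b : 𝓢'(EuclideanSpace ℝ (Fin n), ℂ),
      TemperedDistribution.MemSobolev (s + k + 1 / 2) 2 g_b →
        PsiDO.sobolevNormOn s (PsiDO.lowerHalfSpace n ⊓ V) (A (PsiDO.boundaryLayer n g_b)) ≤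
          C * PsiDO.sobolevNorm (s + k + 1 / 2) g_b := by
  obtain ⟨a, rfl⟩ := hA
  have hm : s + k < -1 / 2 := by
    rw [abs_of_nonpos (by linarith)] at hs
    linarith
  obtain ⟨χ, hχ, hχs, hχV⟩ := PsiDO.exists_cutoff hV
  obtain ⟨κ, hκ, hκi, hKκ⟩ := PsiDO.exists_weightedKernel_le a (by linarith) hχs hχ
    (fun x hx ↦ image_eq_zero_of_notMem_tsupport hx) s
  obtain ⟨c, hc⟩ := PsiDO.exists_eLpNorm_layerLift_le n hm
  have hK := PsiDO.stronglyMeasurable_weightedKernel a hχ s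
  -- The summand 1 makes the constant nonzero, so that it can be moved inside the infimum defining
  -- the norm of the boundary datum.
  refine ⟨(∫⁻ θ, κ θ).toNNReal * c + 1, fun g _ ↦ ?_⟩
  have hC0 : (((∫⁻ θ, κ θ).toNNReal * c + 1 : ℝ≥0) : ℝ≥0∞) ≠ 0 := by simp
  simp only [PsiDO.sobolevNorm, ENNReal.mul_iInf_of_ne hC0 ENNReal.coe_ne_top]
  refine le_iInf₂ fun f hf ↦ ?_
  set W : Lp ℂ 2 (volume : Measure (EuclideanSpace ℝ (Fin n))) := 𝓕 f with hW
  have hw := PsiDO.memLp_layerLift hm (Lp.memLp W)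
  have hF := PsiDO.memLp_integral_kernel hK hκ hκi hKκ hw
  -- The extension U plays the role of χAg: its weighted Fourier transform is the weighted kernel
  -- applied to the lifted datum.
  obtain ⟨U, hU, hUφ⟩ := PsiDO.exists_sobolevNorm_le s hF.toLp
  refine (iInf₂_le U fun φ hφ ↦ ?_).trans (hU.trans ?_)
  · have hφχ : ∀ x ∈ tsupport φ, χ x = 1 := fun x hx ↦ hχV x (hφ hx).2
    rw [PsiDO.Symbol.op_apply, PsiDO.fourier_boundaryLayer_eq_integral hm hf, hUφ]
    simp only [PsiDO.rpow_mul_transpose_apply a hχ hχs φ hφχ s]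
    -- Fubini transfers the kernel from the test function to the layer, where it yields the L²
    -- function defining U.
    rw [← PsiDO.integral_mul_integral_kernel hK hκ hκi hKκ hw
      (PsiDO.memLp_rpow_mul_schwartz (-s / 2) _)]
    refine integral_congr_ae ?_
    filter_upwards [hF.coeFn_toLp] with η hη
    rw [hη]
  · have hWf : eLpNorm W 2 = ‖f‖ₑ := by
      rw [← Lp.enorm_def, ← ofReal_norm, ← ofReal_norm, hW, Lp.norm_fourier_eq]
    rw [Lp.enorm_toLp, ENNReal.coe_add, ENNReal.coe_mul, ENNReal.coe_toNNReal hκi.ne, ← hWf]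
    calc _ ≤ _ := PsiDO.eLpNorm_integral_kernel_le hκ hKκ hw.1
      _ ≤ (∫⁻ θ, κ θ) * (c * eLpNorm W 2) := by
        gcongr
        exact hc W (Lp.memLp W).1
      _ ≤ _ := by
        rw [← mul_assoc]
        gcongr
        exact le_self_add
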